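/- Let $A$ and $B$ be finitely generated free groups, let $C$ be a finitely generated group, let $\varphi:C\to A$ and $\psi:C\to B$ be injective homomorphisms, and let $G=A*_C B$ be the corresponding free product with amalgamation, with $C$ regarded as a subgroup of $G$. For a subgroup $H$ of a group $G$ and $g\in G$ write $H^g=gHg^{-1}$, and put $$N^*_G(H)=\{g\in G\mid H\cap H^g\neq 1\},\qquad Z_g(H)=\{h\in H\mid ghg^{-1}\in H\},\qquad Z_G(H)=\bigcup_{g\in N^*_G(H)\smallsetminus H}Z_g(H).$$ An element of $G=A*_C B$ is called \emph{singular} if it lies in $(N^*_G(C)\smallsetminus C)\cup Z_G(C)$, and \emph{regular} otherwise. Let $x_1,\dots,x_m$ be any finite generating tuple of $A$ and $y_1,\dots,y_n$ any finite generating tuple of $B$. Then the set of regular elements of $G$ is recursive: the set of all words in the letters $x_1^{\pm1},\dots,x_m^{\pm1},y_1^{\pm1},\dots,y_n^{\pm1}$ that represent a regular element of $G$ is a recursive set of words. -/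

import Mathlib

universe u v

/-- The two factors `A` and `B`, as a family indexed by `Bool`. -/
def AmalgamFactor (A B : Type u) : Bool → Type u
  | false => A
  | true => B

instance AmalgamFactor.instGroup (A B : Type u) [Group A] [Group B] :
    ∀ b : Bool, Group (AmalgamFactor A B b)
  | false => inferInstanceAs (Group A)
  | true => inferInstanceAs (Group B)

/-- The two maps `φ : C → A` and `ψ : C → B`, as a family indexed by `Bool`. -/
def amalgamLegs {A B : Type u} {C : Type v} [Group A] [Group B] [Group C]
    (φ : C →* A) (ψ : C →* B) : ∀ b : Bool, C →* AmalgamFactor A B b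
  | false => φ
  | true => ψ

/-- The amalgamated product `A *_C B`: the pushout of groups of `φ : C → A` and `ψ : C → B`. -/
abbrev AmalgamatedProduct {A B : Type u} {C : Type v} [Group A] [Group B] [Group C]
    (φ : C →* A) (ψ : C →* B) : Type (max u v) :=
  Monoid.PushoutI (amalgamLegs φ ψ)

namespace AmalgamatedProduct

variable {A B : Type u} {C : Type v} [Group A] [Group B] [Group C] (φ : C →* A) (ψ : C →* B)

/-- The canonical map of the factor `A` into `A *_C B`. -/
def inl : A →* AmalgamatedProduct φ ψ :=
  Monoid.PushoutI.of (φ := amalgamLegs φ ψ) false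

/-- The canonical map of the factor `B` into `A *_C B`. -/
def inr : B →* AmalgamatedProduct φ ψ :=
  Monoid.PushoutI.of (φ := amalgamLegs φ ψ) true

/-- The image of the amalgamated subgroup `C` in `A *_C B`. -/
def baseSubgroup : Subgroup (AmalgamatedProduct φ ψ) :=
  (Monoid.PushoutI.base (amalgamLegs φ ψ)).range

/-- The element of `A *_C B` represented by a (not necessarily reduced) group word in the letters
`x₁, …, xₘ` (standing for the elements `x i` of `A`) and `y₁, …, yₙ` (standing for the elements
`y j` of `B`). The letter `(s, true)` stands for `s`, the letter `(s, false)` for its inverse. -/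
def evalWord {m n : ℕ} (x : Fin m → A) (y : Fin n → B)
    (w : List ((Fin m ⊕ Fin n) × Bool)) : AmalgamatedProduct φ ψ :=
  FreeGroup.lift (Sum.elim (fun i => inl φ ψ (x i)) (fun j => inr φ ψ (y j))) (FreeGroup.mk w)

end AmalgamatedProduct

/-- The generalized normalizer `N*_G(H)`: all `g` with `H ∩ H ^ g ≠ 1`, where
`H ^ g = g H g⁻¹`. -/
def generalizedNormalizer {G : Type*} [Group G] (H : Subgroup G) : Set G :=
  {g | H ⊓ H.map (MulAut.conj g).toMonoidHom ≠ ⊥}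

/-- `Z_g(H)`: all `h ∈ H` with `h ^ g = g h g⁻¹ ∈ H`. -/
def conjStaySet {G : Type*} [Group G] (H : Subgroup G) (g : G) : Set G :=
  {h | h ∈ H ∧ g * h * g⁻¹ ∈ H}

/-- `Z_G(H)`: the union of the `Z_g(H)` over `g ∈ N*_G(H) \ H`. -/
def conjStayUnion {G : Type*} [Group G] (H : Subgroup G) : Set G :=
  ⋃ g ∈ generalizedNormalizer H \ (H : Set G), conjStaySet H g

/-- The black hole of `G` relative to `H`, i.e. the set of singular elements. -/
def blackHole {G : Type*} [Group G] (H : Subgroup G) : Set G :=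
  (generalizedNormalizer H \ (H : Set G)) ∪ conjStayUnion H

/-- The regular elements of `G` relative to `H`: those outside the black hole. -/
def regularElements {G : Type*} [Group G] (H : Subgroup G) : Set G :=
  (blackHole H)ᶜ

/-!
A finitely generated subgroup of a free group is quasiconvex: prefixes of its reduced words stay in
finitely many of its cosets. A word in such a subgroup `C` therefore has a preimage of linearly
bounded length, `C ∩ g D g⁻¹` is generated by words whose length is bounded in terms of `g` and of
generators of `D`, and an element outside `C` that conjugates a given `c ≠ 1` into `C` can be
replaced by a short one.

In an amalgamated product of free groups the first fact makes normal forms computable, hence also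
membership in `C`. For a reduced product `a₁ ⋯ aₙ` the intersection of `C` with its conjugate is
obtained by intersecting inside one factor at a time, so iterating the second fact bounds generators
of it, and one of them is nontrivial as soon as the intersection is. If `c ∈ C` is conjugated into
`C` by some element outside `C`, the last syllable of that element already does so within its
factor, and the third fact bounds a conjugator. So singular elements have witnesses of primitive
recursively bounded length, and a bounded search finds them.
-/

open FreeGroup hiding map_mul map_one map_inv

section Computability

variable {X β : Type*} [Primcodable X]

/-- All lists of length at most `n` over a finite type: the search space of a bounded search. -/
noncomputable def listsUpTo (β : Type*) [Fintype β] : ℕ → List (List β)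
  | 0 => [[]]
  | n + 1 => [] :: (listsUpTo β n).flatMap fun l => Finset.univ.toList.map fun b => b :: l

theorem mem_listsUpTo [Fintype β] {n : ℕ} {l : List β} :
    l ∈ listsUpTo β n ↔ l.length ≤ n := by
  induction n generalizing l with
  | zero => simp [listsUpTo]
  | succ n ih => cases l <;> simp [listsUpTo, ih]

theorem primrec_listsUpTo (β : Type*) [Fintype β] [Primcodable β] : Primrec (listsUpTo β) := by
  have extend : Primrec fun L : List (List β) =>
      [] :: L.flatMap fun l => Finset.univ.toList.map fun b : β => b :: l :=
    Primrec.list_cons.comp (.const []) <| Primrec.list_flatMap .id <|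
      Primrec.list_map (.const _) (Primrec.list_cons.comp .snd (Primrec.snd.comp .fst))
  refine (Primrec.nat_rec₁ [[]] (extend.comp .snd).to₂).of_eq fun n => ?_
  induction n with
  | zero => rfl
  | succ n ih => simp only [listsUpTo, ← ih]

theorem exists_primrec_boundedSearch [Finite β] [Primcodable β] {R : X → List β → Prop}
    (hR : PrimrecRel R) {B : X → ℕ} (hB : Primrec B) :
    ∃ ρ : X → Option (List β), Primrec ρ ∧ (∀ x y, ρ x = some y → R x y) ∧
      ∀ x, ρ x = none → ∀ y, y.length ≤ B x → ¬ R x y := by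
  classical
  have := Fintype.ofFinite β
  have hswap : PrimrecRel fun y x => R x y := hR.comp .snd .fst
  refine ⟨fun x => ((listsUpTo β (B x)).filter (R x ·)).head?, ?_, ?_, ?_⟩
  · exact Primrec.list_head?.comp
      (hswap.listFilter.comp ((primrec_listsUpTo β).comp hB) .id)
  · intro x y hxy
    simpa using (List.mem_filter.1 (List.mem_of_mem_head? hxy)).2
  · intro x hx y hy
    rw [List.head?_eq_none_iff, List.filter_eq_nil_iff] at hx
    simpa using hx y (mem_listsUpTo.2 hy)

theorem primrecPred_exists_length_le [Finite β] [Primcodable β] {R : X → List β → Prop}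
    (hR : PrimrecRel R) {B : X → ℕ} (hB : Primrec B) :
    PrimrecPred fun x => ∃ y : List β, y.length ≤ B x ∧ R x y := by
  have := Fintype.ofFinite β
  have hswap : PrimrecRel fun y x => R x y := hR.comp .snd .fst
  exact (hswap.exists_mem_list.comp ((primrec_listsUpTo β).comp hB) .id).of_eq fun x => by
    simp only [mem_listsUpTo, id]

theorem primrec₂_of_finite {ι σ : Type*} [Finite ι] [Primcodable ι] [Primcodable σ]
    {f : ι → X → σ} (hf : ∀ i, Primrec (f i)) : Primrec₂ f := by
  classical
  have onList (L : List ι) : Primrec₂ fun i x => if i ∈ L then some (f i x) else none := by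
    induction L with
    | nil => simpa using Primrec₂.const none
    | cons j L ih =>
      refine (Primrec.ite (Primrec.eq.comp .fst (.const j))
        (Primrec.option_some.comp ((hf j).comp .snd)) ih).of_eq fun p => ?_
      by_cases h : p.1 = j <;> simp [h]
  have := Fintype.ofFinite ι
  exact Primrec.option_some_iff.1 ((onList Finset.univ.toList).of_eq
    (g := fun i x => some (f i x)) fun i x => by simp)

end Computability

section Words

variable {α β : Type*}

theorem prefix_append_iff {p a b : List β} :
    p <+: a ++ b ↔ p <+: a ∨ ∃ q, p = a ++ q ∧ q <+: b := by
  constructor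
  · rintro ⟨t, ht⟩
    obtain ⟨q, hq, -⟩ | ⟨q, hq, ht⟩ := List.append_eq_append_iff.1 ht
    · exact .inl ⟨q, hq.symm⟩
    · exact .inr ⟨q, hq, t, ht.symm⟩
  · rintro (h | ⟨q, rfl, h⟩)
    · exact h.trans (List.prefix_append a b)
    · exact (List.prefix_append_right_inj a).2 h

theorem exists_length_le_card_of_forall_prefix_mem {X : Type*} {c : List β → X}
    (hc : ∀ u v w, c u = c v → c (u ++ w) = c (v ++ w)) {S : Finset X} {v : List β}
    (hv : ∀ p, p <+: v → c p ∈ S) : ∃ v' : List β, v'.length ≤ S.card ∧ c v' = c v := by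
  induction hn : v.length using Nat.strong_induction_on generalizing v with
  | _ n ih =>
  by_cases hle : v.length ≤ S.card
  · exact ⟨v, hle, rfl⟩
  obtain ⟨i, hi, j, hj, hne, hij⟩ := Finset.exists_ne_map_eq_of_card_lt_of_maps_to
    (s := Finset.range v.length) (t := S) (f := fun i => c (v.take i))
    (by simpa using hle) (fun i _ => hv _ (List.take_prefix _ _))
  wlog hlt : i < j generalizing i j
  · exact this j hj i hi hne.symm hij.symm (by omega)
  simp only [Finset.mem_range] at hi hj
  -- Cut out the loop `v[i, j)`.
  have hcut (q : List β) : c (v.take i ++ q) = c (v.take j ++ q) := hc _ _ q hij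
  obtain ⟨v', hlen, hv'⟩ := ih (v.take i ++ v.drop j).length (by grind)
    (v := v.take i ++ v.drop j) (fun p hp => by
      obtain hp | ⟨q, rfl, hq⟩ := prefix_append_iff.1 hp
      · exact hv p (hp.trans (List.take_prefix _ _))
      · rw [hcut]
        refine hv _ ?_
        conv_rhs => rw [← List.take_append_drop j v]
        exact (List.prefix_append_right_inj _).2 hq) rfl
  exact ⟨v', hlen, by rw [hv', hcut, List.take_append_drop]⟩

theorem exists_cancellation_of_isReduced {l r : List (α × Bool)} (hl : IsReduced l)
    (hr : IsReduced r) :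
    ∃ p s q : List (α × Bool), l = p ++ s ∧ r = invRev s ++ q ∧ IsReduced (p ++ q) := by
  induction l using List.reverseRecOn generalizing r with
  | nil => exact ⟨[], [], r, rfl, rfl, hr⟩
  | append_singleton l a ih =>
    obtain _ | ⟨b, r⟩ := r
    · exact ⟨l ++ [a], [], [], by simp, rfl, by simpa using hl⟩
    by_cases hab : b = (a.1, !a.2)
    · obtain ⟨p, s, q, hl', hr', hpq⟩ := ih (r := r) (hl.infix ⟨[], [a], by simp⟩)
        (hr.infix ⟨[b], [], by simp⟩)
      exact ⟨p, s ++ [a], q, by simp [hl'], by simp [hr', hab, invRev], hpq⟩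
    · have hjoin : IsReduced ([a] ++ b :: r) := by
        refine List.isChain_cons_cons.2 ⟨fun h₁ => ?_, hr⟩
        by_contra h₂
        exact hab (Prod.ext h₁.symm (by simpa using (Bool.not_eq.2 h₂).symm))
      exact ⟨l ++ [a], [], b :: r, by simp, rfl,
        by simpa using IsReduced.append_overlap hl hjoin (by simp)⟩

theorem exists_toWord_mul_eq [DecidableEq α] (g h : FreeGroup α) :
    ∃ p s q : List (α × Bool), g.toWord = p ++ s ∧ h.toWord = invRev s ++ q ∧
      (g * h).toWord = p ++ q := by
  obtain ⟨p, s, q, hg, hh, hpq⟩ :=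
    exists_cancellation_of_isReduced (isReduced_toWord (x := g)) (isReduced_toWord (x := h))
  refine ⟨p, s, q, hg, hh, ?_⟩
  have hmul : g * h = mk (p ++ q) := by
    rw [← mk_toWord (x := g), ← mk_toWord (x := h), hg, hh]
    simp only [← mul_mk, ← inv_mk]
    group
  rw [hmul, toWord_mk, hpq.reduce_eq]

theorem mk_flatMap {X : Type*} (l : X → List (α × Bool)) (L : List X) :
    mk (L.flatMap l) = (L.map fun x => mk (l x)).prod := by
  induction L with
  | nil => rfl
  | cons x L ih => rw [List.flatMap_cons, ← mul_mk, ih, List.map_cons, List.prod_cons]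

theorem norm_eq_length_toWord [DecidableEq α] (g : FreeGroup α) : g.norm = g.toWord.length := rfl

theorem finite_norm_le [DecidableEq α] [Finite α] (n : ℕ) :
    {g : FreeGroup α | g.norm ≤ n}.Finite :=
  (List.finite_length_le (α × Bool) n).preimage toWord_injective.injOn

end Words

section Substitution

variable {α β γ : Type*}

theorem primrec_reduce [DecidableEq α] [Primcodable α] :
    Primrec (reduce : List (α × Bool) → List (α × Bool)) := by
  -- `reduce` is the right fold that cancels a letter against the head of the reduced tail.
  have hstep : Primrec₂ fun (_ : List (α × Bool)) (p : (α × Bool) × List (α × Bool)) =>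
      (List.casesOn p.2 [p.1] fun hd tl =>
        if p.1.1 = hd.1 ∧ p.1.2 = !hd.2 then tl else p.1 :: hd :: tl : List (α × Bool)) := by
    refine Primrec.list_casesOn (h := fun (z : List (α × Bool) × (α × Bool) × List (α × Bool))
        (y : (α × Bool) × List (α × Bool)) =>
        if z.2.1.1 = y.1.1 ∧ z.2.1.2 = !y.1.2 then y.2 else z.2.1 :: y.1 :: y.2)
      (Primrec.snd.comp .snd) (Primrec.list_cons.comp (Primrec.fst.comp .snd) (.const [])) ?_
    have letter : Primrec fun z : (List (α × Bool) × (α × Bool) × List (α × Bool)) ×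
        (α × Bool) × List (α × Bool) => z.1.2.1 :=
      Primrec.fst.comp (Primrec.snd.comp .fst)
    have head : Primrec fun z : (List (α × Bool) × (α × Bool) × List (α × Bool)) ×
        (α × Bool) × List (α × Bool) => z.2.1 := Primrec.fst.comp .snd
    have tail : Primrec fun z : (List (α × Bool) × (α × Bool) × List (α × Bool)) ×
        (α × Bool) × List (α × Bool) => z.2.2 := Primrec.snd.comp .snd
    exact Primrec.ite (PrimrecPred.and (Primrec.eq.comp (Primrec.fst.comp letter)
        (Primrec.fst.comp head)) (Primrec.eq.comp (Primrec.snd.comp letter)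
        (Primrec.not.comp (Primrec.snd.comp head))))
      tail (Primrec.list_cons.comp letter (Primrec.list_cons.comp head tail))
  refine (Primrec.list_foldr .id (.const []) hstep).of_eq fun l => ?_
  induction l with
  | nil => rfl
  | cons a l ih =>
    rw [reduce.cons, ← ih]
    rfl

theorem primrec_invRev [Primcodable α] :
    Primrec (invRev : List (α × Bool) → List (α × Bool)) :=
  Primrec.list_reverse.comp (Primrec.list_map .id
    (Primrec.pair (Primrec.fst.comp .snd) (Primrec.not.comp (Primrec.snd.comp .snd))))

/-- The image of a word under a homomorphism of free groups, computed letter by letter (and not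
freely reduced). -/
def substWord [DecidableEq α] (f : FreeGroup β →* FreeGroup α) (w : List (β × Bool)) :
    List (α × Bool) :=
  w.flatMap fun x => (f (mk [x])).toWord

theorem mk_substWord [DecidableEq α] (f : FreeGroup β →* FreeGroup α) (w : List (β × Bool)) :
    mk (substWord f w) = f (mk w) := by
  have hletters : (mk w : FreeGroup β) = (w.map fun x => mk [x]).prod := by
    rw [← mk_flatMap, List.flatMap_singleton']
  simp only [substWord, mk_flatMap, mk_toWord, hletters, map_list_prod, List.map_map,
    Function.comp_def]

theorem exists_length_substWord_le [DecidableEq α] [Finite β] (f : FreeGroup β →* FreeGroup α) :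
    ∃ K, ∀ w, (substWord f w).length ≤ K * w.length := by
  obtain ⟨K, hK⟩ := Finite.exists_le fun x : β × Bool => (f (mk [x])).toWord.length
  refine ⟨K, fun w => ?_⟩
  rw [substWord, List.length_flatMap, mul_comm, ← List.length_map, ← smul_eq_mul]
  exact List.sum_le_card_nsmul _ K (List.forall_mem_map.2 fun x _ => hK x)

theorem exists_norm_map_mk_le [DecidableEq α] [Finite β] (f : FreeGroup β →* FreeGroup α) :
    ∃ K, ∀ w, (f (mk w)).norm ≤ K * w.length := by
  obtain ⟨K, hK⟩ := exists_length_substWord_le f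
  exact ⟨K, fun w => by rw [← mk_substWord]; exact norm_mk_le.trans (hK w)⟩

theorem primrec_substWord [DecidableEq α] [Finite β] [Primcodable β] [Primcodable α]
    (f : FreeGroup β →* FreeGroup α) : Primrec (substWord f) :=
  Primrec.list_flatMap .id ((Primrec.dom_finite fun x : β × Bool => (f (mk [x])).toWord).comp .snd)

theorem primrecRel_map_mk_eq [Primcodable α] [Finite β] [Primcodable β] [Finite γ] [Primcodable γ]
    (f : FreeGroup β →* FreeGroup α) (g : FreeGroup γ →* FreeGroup α) :
    PrimrecRel fun v w => f (mk v) = g (mk w) := by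
  classical
  exact (Primrec.eq.comp (primrec_reduce.comp ((primrec_substWord f).comp .fst))
    (primrec_reduce.comp ((primrec_substWord g).comp .snd))).of_eq fun p => by
      simp only [← mk_substWord, ← toWord_inj, toWord_mk]

end Substitution

section Lifting

variable {α β : Type*} {G : Type*} [Group G]

theorem exists_lift_of_surjective {f : FreeGroup α →* G} (hf : Function.Surjective f)
    (h : FreeGroup β →* G) : ∃ j : FreeGroup β →* FreeGroup α, ∀ g, f (j g) = h g := by
  choose s hs using hf
  have hcomp : f.comp (lift fun b => s (h (of b))) = h := by
    ext b
    simp [hs]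
  exact ⟨_, DFunLike.congr_fun hcomp⟩

theorem exists_length_le_mul_of_surjective [Finite β] {f : FreeGroup α →* G}
    (hf : Function.Surjective f) (h : FreeGroup β →* G) :
    ∃ M, ∀ l, ∃ w : List (α × Bool), w.length ≤ M * l.length ∧ f (mk w) = h (mk l) := by
  classical
  obtain ⟨j, hj⟩ := exists_lift_of_surjective hf h
  obtain ⟨M, hM⟩ := exists_length_substWord_le j
  exact ⟨M, fun l => ⟨substWord j l, hM l, by rw [mk_substWord, hj]⟩⟩

end Lifting

section Quasiconvexity

variable {α β : Type*} [DecidableEq α]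

/-- If cancellation shortens neither `b * u` nor `b * u⁻¹` below `b`, then the letters of `u`
cancelled by `b` from the left and by `b⁻¹` from the right do not overlap. -/
theorem exists_overlap_of_norm_le {b u : FreeGroup α} (hu : u ≠ 1) (hle : b.norm ≤ (b * u).norm)
    (hle' : b.norm ≤ (b * u⁻¹).norm) :
    ∃ p s p' s' z : List (α × Bool), b.toWord = p ++ s ∧ b.toWord = p' ++ s' ∧ z ≠ [] ∧
      u.toWord = invRev s ++ z ++ s' ∧ (b * u).toWord = p ++ z ++ s' ∧
      (u * b⁻¹).toWord = invRev s ++ z ++ invRev p' := by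
  obtain ⟨p, s, q, hb, hu₁, hbu⟩ := exists_toWord_mul_eq b u
  obtain ⟨p', s', q', hb', hu₂, hbu'⟩ := exists_toWord_mul_eq b u⁻¹
  replace hu₂ : u.toWord = invRev q' ++ s' := by
    rw [← invRev_invRev (L₁ := u.toWord), ← toWord_inv, hu₂, invRev_append, invRev_invRev]
  have hlen := congrArg List.length (hu₁.symm.trans hu₂)
  simp only [norm_eq_length_toWord, hbu, hbu'] at hle hle'
  rw [hb] at hle
  rw [hb'] at hle'
  simp only [List.length_append, invRev_length] at hle hle' hlen
  obtain ⟨z, hz⟩ : invRev s <+: invRev q' :=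
    List.prefix_of_prefix_length_le (hu₁ ▸ List.prefix_append _ _)
      (hu₂ ▸ List.prefix_append _ _) (by simp only [invRev_length]; omega)
  have hq : q = z ++ s' := List.append_cancel_left <| by
    rw [← hu₁, hu₂, ← hz, List.append_assoc]
  refine ⟨p, s, p', s', z, hb, hb', ?_, by rw [hu₁, hq, List.append_assoc],
    by rw [hbu, hq, List.append_assoc], ?_⟩
  · rintro rfl
    -- Otherwise `s` and `s'` are suffixes of `b` of the same length, so `u = s⁻¹ s = 1`.
    obtain rfl : s = s' := (List.append_inj' (hb.symm.trans hb') (by grind [invRev_length])).2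
    refine hu ?_
    rw [← mk_toWord (x := u), hu₁, hq, List.nil_append, ← mul_mk, ← inv_mk, inv_mul_cancel]
  · rw [← inv_inv (u * b⁻¹), mul_inv_rev, inv_inv, toWord_inv, hbu', invRev_append, hz]

theorem exists_prefix_toWord_conj {b u : FreeGroup α} (hu : u ≠ 1) (hle : b.norm ≤ (b * u).norm)
    (hle' : b.norm ≤ (b * u⁻¹).norm) :
    ∃ p s : List (α × Bool), b.toWord = p ++ s ∧ s.length ≤ u.norm ∧
      p <+: (b * u * b⁻¹).toWord := by
  obtain ⟨p, s, p', s', z, hb, hb', hz, hu', hbu, hbu'⟩ := exists_overlap_of_norm_le hu hle hle'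
  have hleft : IsReduced (p ++ z) :=
    (hbu ▸ isReduced_toWord (x := b * u)).infix (List.prefix_append _ s').isInfix
  have hright : IsReduced (z ++ invRev p') :=
    (hbu' ▸ isReduced_toWord (x := u * b⁻¹)).infix ⟨invRev s, [], by simp⟩
  have hconj : b * u * b⁻¹ = mk (p ++ z ++ invRev p') := by
    rw [← mk_toWord (x := b * u), hbu, ← mk_toWord (x := b), hb']
    simp only [← mul_mk, ← inv_mk]
    group
  refine ⟨p, s, hb, by grind [norm_eq_length_toWord, invRev_length], ?_⟩
  rw [hconj, toWord_mk, (IsReduced.append_overlap hleft hright hz).reduce_eq, List.append_assoc]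
  exact List.prefix_append _ _

/-- A subgroup `H` of a free group is `R`-quasiconvex if every prefix of the reduced form of an
element of `H` lies in a right coset `H t` with `t` of norm at most `R`. -/
def IsQuasiconvexSubgroup (H : Subgroup (FreeGroup α)) (R : ℕ) : Prop :=
  ∀ h ∈ H, ∀ p, p <+: h.toWord → ∃ t : FreeGroup α, t.norm ≤ R ∧ mk p * t⁻¹ ∈ H

namespace IsQuasiconvexSubgroup

variable {H K : Subgroup (FreeGroup α)} {R S : ℕ}

theorem mono (hH : IsQuasiconvexSubgroup H R) (hRS : R ≤ S) : IsQuasiconvexSubgroup H S :=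
  fun h hh p hp => (hH h hh p hp).imp fun _ ht => ⟨ht.1.trans hRS, ht.2⟩

theorem of_closure {T : Set (FreeGroup α)} (hT : ∀ t ∈ T, t.norm ≤ R) :
    IsQuasiconvexSubgroup (Subgroup.closure T) R := by
  intro h hh
  induction hh using Subgroup.closure_induction with
  | mem x hx =>
    exact fun p hp => ⟨mk p, norm_mk_le.trans (hp.length_le.trans (hT x hx)),
      by simp only [mul_inv_cancel, one_mem]⟩
  | one =>
    intro p hp
    obtain rfl : p = [] := by simpa using hp
    exact ⟨1, by simp, by simp [← one_eq_mk]⟩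
  | mul g h hg _ ihg ihh =>
    intro p hp
    obtain ⟨a, s, b, hga, hhb, hgh⟩ := exists_toWord_mul_eq g h
    obtain hp | ⟨q, rfl, hq⟩ := prefix_append_iff.1 (hgh ▸ hp)
    · exact ihg p (hp.trans (hga ▸ List.prefix_append _ _))
    · obtain ⟨t, ht, hmem⟩ := ihh (invRev s ++ q) (hhb ▸ (List.prefix_append_right_inj _).2 hq)
      have hpre : mk (a ++ q) = g * mk (invRev s ++ q) := by
        rw [← mk_toWord (x := g), hga]
        simp only [← mul_mk, ← inv_mk]
        group
      exact ⟨t, ht, by rw [hpre, mul_assoc]; exact mul_mem hg hmem⟩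
  | inv g hg ih =>
    rintro p ⟨r, hr⟩
    have hgr : g.toWord = invRev r ++ invRev p := by
      rw [← invRev_append, hr, toWord_inv, invRev_invRev]
    obtain ⟨t, ht, hmem⟩ := ih (invRev r) (hgr ▸ List.prefix_append _ _)
    have hpre : mk p = g⁻¹ * mk (invRev r) := by
      rw [← mk_toWord (x := g), hgr, ← mul_mk, ← inv_mk, ← inv_mk]
      group
    exact ⟨t, ht, by rw [hpre, mul_assoc]; exact mul_mem (inv_mem hg) hmem⟩

theorem inf [Fintype α] (hH : IsQuasiconvexSubgroup H R) (hK : IsQuasiconvexSubgroup K S) :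
    IsQuasiconvexSubgroup (H ⊓ K)
      ((listsUpTo (α × Bool) R).length * (listsUpTo (α × Bool) S).length) := by
  classical
  intro h hh p hp
  let coset (L : Subgroup (FreeGroup α)) (w : List (α × Bool)) :
      Quotient (QuotientGroup.rightRel L) := Quotient.mk _ (mk w)
  have coset_eq {L : Subgroup (FreeGroup α)} {u v : List (α × Bool)} :
      coset L u = coset L v ↔ mk v * (mk u)⁻¹ ∈ L :=
    Quotient.eq.trans QuotientGroup.rightRel_apply
  let ball (L : Subgroup (FreeGroup α)) (n : ℕ) : Finset (Quotient (QuotientGroup.rightRel L)) :=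
    (listsUpTo (α × Bool) n).toFinset.image (coset L)
  have card_ball_le (L : Subgroup (FreeGroup α)) (n : ℕ) :
      (ball L n).card ≤ (listsUpTo (α × Bool) n).length :=
    Finset.card_image_le.trans (List.toFinset_card_le _)
  have coset_mem_ball {L : Subgroup (FreeGroup α)} {n : ℕ} (hL : IsQuasiconvexSubgroup L n)
      (hhL : h ∈ L) {q : List (α × Bool)} (hq : q <+: h.toWord) : coset L q ∈ ball L n := by
    obtain ⟨t, ht, hmem⟩ := hL h hhL q hq
    exact Finset.mem_image.2 ⟨t.toWord, List.mem_toFinset.2 (mem_listsUpTo.2 ht),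
      coset_eq.2 (by rwa [mk_toWord])⟩
  obtain ⟨w, hlen, hw⟩ := exists_length_le_card_of_forall_prefix_mem
    (c := fun w => (coset H w, coset K w)) (S := ball H R ×ˢ ball K S) (v := p)
    (fun u v w huv => by
      simp only [Prod.mk.injEq, coset_eq] at huv ⊢
      rwa [← mul_mk, ← mul_mk, mul_inv_rev, mul_assoc, mul_inv_cancel_left])
    (fun q hq => Finset.mk_mem_product (coset_mem_ball hH hh.1 (hq.trans hp))
      (coset_mem_ball hK hh.2 (hq.trans hp)))
  simp only [Prod.mk.injEq, coset_eq] at hw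
  rw [Finset.card_product] at hlen
  exact ⟨mk w, norm_mk_le.trans (hlen.trans (Nat.mul_le_mul (card_ball_le H R) (card_ball_le K S))),
    hw⟩

theorem exists_list_prod_eq (hH : IsQuasiconvexSubgroup H R) {h : FreeGroup α} (hh : h ∈ H) :
    ∃ L : List (FreeGroup α), (∀ x ∈ L, x ∈ H ∧ x.norm ≤ 2 * R + 1) ∧
      L.length ≤ h.norm + 1 ∧ L.prod = h := by
  suffices key : ∀ p, p <+: h.toWord → ∀ t : FreeGroup α, t.norm ≤ R → mk p * t⁻¹ ∈ H →
      ∃ L : List (FreeGroup α), (∀ x ∈ L, x ∈ H ∧ x.norm ≤ 2 * R + 1) ∧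
        L.length ≤ p.length + 1 ∧ L.prod = mk p * t⁻¹ by
    simpa only [mk_toWord, inv_one, mul_one, norm_eq_length_toWord] using
      key h.toWord List.prefix_rfl 1 (by simp) (by simpa only [mk_toWord, inv_one, mul_one])
  intro p
  induction p using List.reverseRecOn with
  | nil =>
    intro _ t ht hmem
    rw [← one_eq_mk, one_mul] at hmem ⊢
    exact ⟨[t⁻¹], by simpa [norm_inv_eq, hmem] using by omega, by simp, by simp⟩
  | append_singleton p x ih =>
    intro hp t ht hmem
    have hp' : p <+: h.toWord := (List.prefix_append _ _).trans hp
    obtain ⟨r, hr, hrmem⟩ := hH h hh p hp'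
    obtain ⟨L, hL, hlen, hprod⟩ := ih hp' r hr hrmem
    have hsplit : mk (p ++ [x]) * t⁻¹ = (mk p * r⁻¹) * (r * mk [x] * t⁻¹) := by
      rw [← mul_mk]
      group
    have hnorm : (r * mk [x] * t⁻¹).norm ≤ 2 * R + 1 := by
      have h₁ := norm_mul_le (r * mk [x]) t⁻¹
      have h₂ := norm_mul_le r (mk [x])
      have h₃ : (mk [x]).norm ≤ 1 := norm_mk_le
      rw [norm_inv_eq] at h₁
      omega
    have hstep : r * mk [x] * t⁻¹ ∈ H := (H.mul_mem_cancel_left hrmem).1 (hsplit ▸ hmem)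
    refine ⟨L ++ [r * mk [x] * t⁻¹], ?_, by simpa using hlen, by simp [hprod, hsplit]⟩
    simpa only [List.forall_mem_append, List.forall_mem_singleton] using ⟨hL, hstep, hnorm⟩

theorem le_closure (hH : IsQuasiconvexSubgroup H R) :
    H ≤ Subgroup.closure {h | h ∈ H ∧ h.norm ≤ 2 * R + 1} := by
  intro h hh
  obtain ⟨L, hL, -, rfl⟩ := hH.exists_list_prod_eq hh
  exact list_prod_mem fun x hx => Subgroup.subset_closure (hL x hx)

theorem exists_length_le_preimage [Finite α] {f : FreeGroup β →* FreeGroup α}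
    (hf : IsQuasiconvexSubgroup f.range R) :
    ∃ M, ∀ h ∈ f.range, ∃ l : List (β × Bool), l.length ≤ M * (h.norm + 1) ∧ f (mk l) = h := by
  classical
  have hpre : ∀ h ∈ f.range, ∃ l, f (mk l) = h := by
    rintro _ ⟨g, rfl⟩
    exact ⟨g.toWord, by rw [mk_toWord]⟩
  choose! l hl using hpre
  have := (finite_norm_le (α := α) (2 * R + 1)).to_subtype
  obtain ⟨M, hM⟩ := Finite.exists_le
    fun x : {g : FreeGroup α | g.norm ≤ 2 * R + 1} => (l x.1).length
  refine ⟨M, fun h hh => ?_⟩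
  obtain ⟨L, hL, hlen, rfl⟩ := hf.exists_list_prod_eq hh
  refine ⟨L.flatMap l, ?_, ?_⟩
  · calc (L.flatMap l).length = (L.map fun x => (l x).length).sum := List.length_flatMap
      _ ≤ (L.map fun x => (l x).length).length • M := List.sum_le_card_nsmul _ _
          (List.forall_mem_map.2 fun x hx => hM ⟨x, (hL x hx).2⟩)
      _ ≤ M * (L.prod.norm + 1) := by
          rw [List.length_map, smul_eq_mul, mul_comm]
          exact Nat.mul_le_mul_left M hlen
  · rw [mk_flatMap, map_list_prod, List.map_map]
    exact congrArg List.prod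
      ((List.map_congr_left fun x hx => hl x (hL x hx).1).trans (List.map_id' L))

theorem exists_norm_le_of_conj_mem (hH : IsQuasiconvexSubgroup H R) {a u : FreeGroup α}
    (hu : u ≠ 1) (ha : a * u * a⁻¹ ∈ H) : ∃ a', a'.norm ≤ R + u.norm ∧ a * a'⁻¹ ∈ H := by
  obtain ⟨b, hb, hmin⟩ : ∃ b, a * b⁻¹ ∈ H ∧ ∀ b', a * b'⁻¹ ∈ H → b.norm ≤ b'.norm := by
    obtain ⟨b, hb, hm⟩ := (InvImage.wf (norm (α := α)) Nat.lt_wfRel.wf).has_min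
      {b : FreeGroup α | a * b⁻¹ ∈ H} ⟨a, by simp⟩
    exact ⟨b, hb, fun b' hb' => not_lt.1 (hm b' hb')⟩
  have hbu : b * u * b⁻¹ ∈ H := by
    convert mul_mem (mul_mem (inv_mem hb) ha) hb using 1
    group
  have hle : b.norm ≤ (b * u).norm := hmin _ <| by
    convert mul_mem hb (inv_mem hbu) using 1
    group
  have hle' : b.norm ≤ (b * u⁻¹).norm := hmin _ <| by
    convert mul_mem hb hbu using 1
    group
  obtain ⟨p, s, hps, hs, hp⟩ := exists_prefix_toWord_conj hu hle hle'
  obtain ⟨t, ht, hmem⟩ := hH _ hbu p hp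
  refine ⟨t * mk s, ?_, ?_⟩
  · calc (t * mk s).norm ≤ t.norm + (mk s).norm := norm_mul_le _ _
      _ ≤ R + u.norm := Nat.add_le_add ht (norm_mk_le.trans hs)
  · convert mul_mem hb hmem using 1
    rw [← mk_toWord (x := b), hps, ← mul_mk]
    group

end IsQuasiconvexSubgroup

theorem exists_isQuasiconvexSubgroup_range [Finite β] (f : FreeGroup β →* FreeGroup α) :
    ∃ R, IsQuasiconvexSubgroup f.range R := by
  obtain ⟨R, hR⟩ := Finite.exists_le fun x : β => (f (of x)).norm
  have hrange : f.range = Subgroup.closure (f '' Set.range of) := by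
    rw [← MonoidHom.map_closure, closure_range_of, MonoidHom.range_eq_map]
  refine ⟨R, hrange ▸ .of_closure ?_⟩
  rintro _ ⟨_, ⟨x, rfl⟩, rfl⟩
  exact hR x

end Quasiconvexity

section FiniteRank

variable {β X H : Type*} [Finite β] [Group H]

/-- Homomorphisms to a group of order two separate the free generators, and only finitely many
homomorphisms to it exist. -/
theorem finite_of_freeGroup_surjective {f : FreeGroup β →* FreeGroup X}
    (hf : Function.Surjective f) : Finite X := by
  classical
  have finite_hom : Finite (X → Multiplicative (ZMod 2)) := by
    refine Finite.of_injective (β := β → Multiplicative (ZMod 2))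
      (fun g b => lift g (f (of b))) fun g g' h => lift.injective ?_
    have hcomp : (lift g).comp f = (lift g').comp f := ext_hom _ _ (congrFun h)
    exact (MonoidHom.cancel_right hf).1 hcomp
  refine Finite.of_injective (β := X → Multiplicative (ZMod 2))
    (fun x => Pi.mulSingle x (.ofAdd 1)) fun x y h => ?_
  by_contra hne
  have hx := congrFun h x
  simp only [Pi.mulSingle_eq_same, Pi.mulSingle_eq_of_ne hne] at hx
  exact absurd hx (by decide)

theorem exists_mulEquiv_freeGroup_fin [IsFreeGroup H] {f : FreeGroup β →* H}
    (hf : Function.Surjective f) : ∃ r : ℕ, Nonempty (H ≃* FreeGroup (Fin r)) := by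
  let κ := IsFreeGroup.toFreeGroup H
  have : Finite (IsFreeGroup.Generators H) :=
    finite_of_freeGroup_surjective (f := κ.toMonoidHom.comp f) (κ.surjective.comp hf)
  obtain ⟨r, ⟨σ⟩⟩ := Finite.exists_equiv_fin (IsFreeGroup.Generators H)
  exact ⟨r, ⟨κ.trans (freeGroupCongr σ)⟩⟩

end FiniteRank

section ConjPullback

variable {Γ C H H' : Type*} [Group C] [Group H] [Group H']

/-- The subgroup `D` is generated by elements that `k` represents by words of length at most `N`. -/
def GeneratedByShort (k : FreeGroup Γ →* C) (N : ℕ) (D : Subgroup C) : Prop :=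
  D ≤ Subgroup.closure {c | c ∈ D ∧ ∃ l : List (Γ × Bool), l.length ≤ N ∧ k (mk l) = c}

/-- The subgroup of all `c` with `θ c ∈ g (θ D) g⁻¹`. -/
def conjPullback (θ : C →* H) (g : H) (D : Subgroup C) : Subgroup C :=
  ((D.map θ).map (MulAut.conj g).toMonoidHom).comap θ

theorem mem_conjPullback {θ : C →* H} {g : H} {D : Subgroup C} {c : C} :
    c ∈ conjPullback θ g D ↔ ∃ d ∈ D, g⁻¹ * θ c * g = θ d := by
  simp only [conjPullback, Subgroup.mem_comap, Subgroup.mem_map, MulEquiv.coe_toMonoidHom,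
    MulAut.conj_apply, exists_exists_and_eq_and]
  refine exists_congr fun d => and_congr_right fun _ => ?_
  rw [mul_inv_eq_iff_eq_mul, eq_comm, mul_assoc, inv_mul_eq_iff_eq_mul]

theorem conjPullback_comp {κ : H →* H'} (hκ : Function.Injective κ) (θ : C →* H) (g : H)
    (D : Subgroup C) : conjPullback (κ.comp θ) (κ g) D = conjPullback θ g D := by
  ext c
  simp only [mem_conjPullback, MonoidHom.comp_apply, ← map_inv, ← map_mul, hκ.eq_iff]

theorem mem_conjPullback_top {θ : C →* H} {g : H} {c : C} :
    c ∈ conjPullback θ g ⊤ ↔ g⁻¹ * θ c * g ∈ θ.range := by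
  simp only [mem_conjPullback, Subgroup.mem_top, true_and, MonoidHom.mem_range, eq_comm]

theorem conjPullback_mul_top (θ : C →* H) (g : H) (c : C) :
    conjPullback θ (g * θ c) ⊤ = conjPullback θ g ⊤ := by
  ext b
  have hconj : (g * θ c)⁻¹ * θ b * (g * θ c) = θ c⁻¹ * (g⁻¹ * θ b * g) * θ c := by
    rw [map_inv, mul_inv_rev]
    simp only [mul_assoc]
  simp only [mem_conjPullback_top, hconj]
  rw [θ.range.mul_mem_cancel_right ⟨c, rfl⟩, θ.range.mul_mem_cancel_left ⟨c⁻¹, rfl⟩]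

theorem GeneratedByShort.exists_ne_one {k : FreeGroup Γ →* C} {N : ℕ} {D : Subgroup C}
    (hD : GeneratedByShort k N D) (hne : D ≠ ⊥) :
    ∃ l : List (Γ × Bool), l.length ≤ N ∧ k (mk l) ∈ D ∧ k (mk l) ≠ 1 := by
  by_contra! h
  refine hne (eq_bot_iff.2 (hD.trans ((Subgroup.closure_le _).2 ?_)))
  rintro _ ⟨hmem, l, hl, rfl⟩
  exact h l hl hmem

theorem generatedByShort_top {k : FreeGroup Γ →* C} (hk : Function.Surjective k) :
    GeneratedByShort k 1 ⊤ := by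
  rw [GeneratedByShort, ← MonoidHom.range_eq_top.2 hk, MonoidHom.range_eq_map,
    ← closure_range_of, MonoidHom.map_closure]
  refine Subgroup.closure_mono ?_
  rintro _ ⟨_, ⟨x, rfl⟩, rfl⟩
  exact ⟨Subgroup.subset_closure ⟨of x, ⟨x, rfl⟩, rfl⟩, [(x, true)], by simp, rfl⟩

end ConjPullback

section FreeFactor

variable {α Λ Γ C : Type*} [Group C]

theorem exists_primrec_preimage [Finite α] [Primcodable α] [Finite Λ] [Primcodable Λ] [Finite Γ]
    [Primcodable Γ] (e : FreeGroup Λ →* FreeGroup α) (f : FreeGroup Γ →* FreeGroup α) :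
    ∃ ρ : List (Λ × Bool) → Option (List (Γ × Bool)), Primrec ρ ∧
      (∀ w l, ρ w = some l → e (mk w) = f (mk l)) ∧ ∀ w, ρ w = none → e (mk w) ∉ f.range := by
  classical
  obtain ⟨R, hR⟩ := exists_isQuasiconvexSubgroup_range f
  obtain ⟨M, hM⟩ := hR.exists_length_le_preimage
  obtain ⟨K, hK⟩ := exists_norm_map_mk_le e
  obtain ⟨ρ, hρ, hsome, hnone⟩ := exists_primrec_boundedSearch
    (primrecRel_map_mk_eq e f) (B := fun w => M * (K * w.length + 1))
    (Primrec.nat_mul.comp (.const M) <| Primrec.succ.comp <|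
      Primrec.nat_mul.comp (.const K) Primrec.list_length)
  refine ⟨ρ, hρ, hsome, fun w hw hmem => ?_⟩
  obtain ⟨l, hlen, hl⟩ := hM _ hmem
  exact hnone w hw l (hlen.trans (Nat.mul_le_mul_left M (Nat.succ_le_succ (hK w)))) hl.symm

theorem primrecPred_map_mk_eq_one [Primcodable α] [Finite Γ] [Primcodable Γ]
    (f : FreeGroup Γ →* FreeGroup α) : PrimrecPred fun l => f (mk l) = 1 :=
  ((primrecRel_map_mk_eq f f).comp .id (.const [])).of_eq fun l => by
    rw [← one_eq_mk, map_one, id]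

theorem GeneratedByShort.isQuasiconvexSubgroup_map_conj [DecidableEq α] {k : FreeGroup Γ →* C}
    {θ : C →* FreeGroup α} {K N : ℕ} (hK : ∀ l, (θ (k (mk l))).norm ≤ K * l.length)
    {D : Subgroup C} (hD : GeneratedByShort k N D) (g : FreeGroup α) :
    IsQuasiconvexSubgroup ((D.map θ).map (MulAut.conj g).toMonoidHom) (K * N + 2 * g.norm) := by
  have hclosure : D = Subgroup.closure
      {c | c ∈ D ∧ ∃ l : List (Γ × Bool), l.length ≤ N ∧ k (mk l) = c} :=
    le_antisymm hD ((Subgroup.closure_le _).2 fun c hc => hc.1)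
  rw [hclosure, MonoidHom.map_closure, MonoidHom.map_closure]
  refine .of_closure ?_
  rintro _ ⟨_, ⟨_, ⟨_, l, hl, rfl⟩, rfl⟩, rfl⟩
  calc (g * θ (k (mk l)) * g⁻¹).norm
      ≤ (g * θ (k (mk l))).norm + (g⁻¹).norm := norm_mul_le _ _
    _ ≤ g.norm + (θ (k (mk l))).norm + (g⁻¹).norm := Nat.add_le_add_right (norm_mul_le _ _) _
    _ ≤ g.norm + K * N + g.norm := by
        rw [norm_inv_eq]
        gcongr
        exact (hK l).trans (Nat.mul_le_mul_left K hl)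
    _ = K * N + 2 * g.norm := by ring

theorem IsQuasiconvexSubgroup.generatedByShort_comap [DecidableEq α] {k : FreeGroup Γ →* C}
    {θ : C →* FreeGroup α} (hθ : Function.Injective θ) {M R : ℕ}
    (hM : ∀ h ∈ θ.range, ∃ l : List (Γ × Bool), l.length ≤ M * (h.norm + 1) ∧ θ (k (mk l)) = h)
    {J : Subgroup (FreeGroup α)} (hJ : IsQuasiconvexSubgroup J R) (hJθ : J ≤ θ.range) :
    GeneratedByShort k (M * (2 * R + 2)) (J.comap θ) := by
  rw [GeneratedByShort, ← Subgroup.map_le_map_iff_of_injective hθ, Subgroup.map_comap_eq,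
    inf_eq_right.2 hJθ, MonoidHom.map_closure]
  refine hJ.le_closure.trans (Subgroup.closure_mono ?_)
  rintro h ⟨hmem, hnorm⟩
  obtain ⟨l, hlen, rfl⟩ := hM h (hJθ hmem)
  exact ⟨k (mk l), ⟨hmem, l, hlen.trans (Nat.mul_le_mul_left M (by omega)), rfl⟩, rfl⟩

theorem exists_primrec_growth [Finite α] [Primcodable α] [Finite Λ] [Finite Γ]
    (e : FreeGroup Λ →* FreeGroup α) {k : FreeGroup Γ →* C} (hk : Function.Surjective k)
    {θ : C →* FreeGroup α} (hθ : Function.Injective θ) :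
    ∃ F : ℕ → ℕ → ℕ, Primrec₂ F ∧ ∀ N D, GeneratedByShort k N D → ∀ w : List (Λ × Bool),
      GeneratedByShort k (F N w.length) (conjPullback θ (e (mk w)) D) := by
  classical
  have := Fintype.ofFinite α
  have hrange : (θ.comp k).range = θ.range := by
    rw [MonoidHom.range_comp, MonoidHom.range_eq_top.2 hk, ← MonoidHom.range_eq_map]
  obtain ⟨R, hR⟩ := exists_isQuasiconvexSubgroup_range (θ.comp k)
  obtain ⟨M, hM⟩ := hR.exists_length_le_preimage
  obtain ⟨K, hK⟩ := exists_norm_map_mk_le (θ.comp k)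
  obtain ⟨E, hE⟩ := exists_norm_map_mk_le e
  rw [hrange] at hR hM
  let ball (n : ℕ) : ℕ := (listsUpTo (α × Bool) n).length
  refine ⟨fun N n => M * (2 * (ball (K * N + 2 * (E * n)) * ball R) + 2), ?_, fun N D hD w => ?_⟩
  · have hball : Primrec ball := Primrec.list_length.comp (primrec_listsUpTo _)
    have hradius : Primrec₂ fun N n => K * N + 2 * (E * n) :=
      Primrec.nat_add.comp (Primrec.nat_mul.comp (.const K) .fst)
        (Primrec.nat_mul.comp (.const 2) (Primrec.nat_mul.comp (.const E) .snd))
    exact Primrec.nat_mul.comp (.const M) <| Primrec.nat_add.comp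
      (Primrec.nat_mul.comp (.const 2) (Primrec.nat_mul.comp (hball.comp hradius) (.const _)))
      (.const 2)
  · have hconj := (hD.isQuasiconvexSubgroup_map_conj hK (e (mk w))).mono
      (Nat.add_le_add_left (Nat.mul_le_mul_left 2 (hE w)) _)
    have hcomap : conjPullback θ (e (mk w)) D =
        ((D.map θ).map (MulAut.conj (e (mk w))).toMonoidHom ⊓ θ.range).comap θ := by
      rw [Subgroup.comap_inf, MonoidHom.range_eq_map, Subgroup.comap_map_eq_self_of_injective hθ,
        inf_top_eq, conjPullback]
    rw [hcomap]
    exact (hconj.inf hR).generatedByShort_comap hθ hM inf_le_right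

theorem exists_length_le_conj_mem [Finite α] [Finite Γ] {e : FreeGroup Λ →* FreeGroup α}
    (he : Function.Surjective e) (f : FreeGroup Γ →* FreeGroup α) :
    ∃ B : ℕ, ∀ l : List (Γ × Bool), f (mk l) ≠ 1 → ∀ a ∉ f.range, a * f (mk l) * a⁻¹ ∈ f.range →
      ∃ w : List (Λ × Bool), w.length ≤ B * (l.length + 1) ∧ e (mk w) ∉ f.range ∧
        e (mk w) * f (mk l) * (e (mk w))⁻¹ ∈ f.range := by
  classical
  obtain ⟨R, hR⟩ := exists_isQuasiconvexSubgroup_range f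
  obtain ⟨K, hK⟩ := exists_norm_map_mk_le f
  obtain ⟨M, hM⟩ := exists_length_le_mul_of_surjective he (MonoidHom.id (FreeGroup α))
  refine ⟨M * (R + K), fun l hl a ha hconj => ?_⟩
  obtain ⟨b, hb, hab⟩ := hR.exists_norm_le_of_conj_mem hl hconj
  obtain ⟨w, hw, hwb⟩ := hM b.toWord
  rw [MonoidHom.id_apply, mk_toWord] at hwb
  refine ⟨w, ?_, ?_, ?_⟩
  · calc w.length ≤ M * b.norm := hw
      _ ≤ M * (R + K * l.length) := by grw [hb, hK l]
      _ ≤ M * (R + K) * (l.length + 1) := by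
        rw [mul_assoc]
        gcongr
        nlinarith [Nat.zero_le (R * l.length)]
  · rw [hwb]
    exact fun hbf => ha (by simpa using mul_mem hab hbf)
  · rw [hwb]
    convert mul_mem (mul_mem (inv_mem hab) hconj) hab using 1
    group

end FreeFactor

section FactorAlgorithm

variable {Λ Γ H H' C : Type*} [Primcodable Λ] [Primcodable Γ] [Group H] [Group H'] [Group C]

/-- What the algorithm for an amalgamated product uses of a factor `H` with amalgamated subgroup
`θ : C →* H`, where `e` and `k` evaluate words in generators of `H` and of `C`. -/
structure FactorAlgorithm (e : FreeGroup Λ →* H) (k : FreeGroup Γ →* C) (θ : C →* H) where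
  /-- Decides membership in the range of `θ` and computes preimages. -/
  rewrite : List (Λ × Bool) → Option (List (Γ × Bool))
  primrec_rewrite : Primrec rewrite
  eval_of_rewrite_eq_some : ∀ w l, rewrite w = some l → e (mk w) = θ (k (mk l))
  notMem_of_rewrite_eq_none : ∀ w, rewrite w = none → e (mk w) ∉ θ.range
  /-- Computes `θ` on words. -/
  incl : List (Γ × Bool) → List (Λ × Bool)
  primrec_incl : Primrec incl
  eval_incl : ∀ l, e (mk (incl l)) = θ (k (mk l))
  primrecPred_eq_one : PrimrecPred fun l => k (mk l) = 1
  /-- Bounds the length of generators of `conjPullback`. -/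
  growth : ℕ → ℕ → ℕ
  primrec_growth : Primrec₂ growth
  generatedByShort_conjPullback : ∀ N D, GeneratedByShort k N D → ∀ w : List (Λ × Bool),
    GeneratedByShort k (growth N w.length) (conjPullback θ (e (mk w)) D)
  /-- Bounds the length of elements outside the range of `θ` conjugating into it. -/
  radius : ℕ
  exists_short_conj : ∀ l : List (Γ × Bool), k (mk l) ≠ 1 → ∀ a ∉ θ.range,
    a * θ (k (mk l)) * a⁻¹ ∈ θ.range →
      ∃ w : List (Λ × Bool), w.length ≤ radius * (l.length + 1) ∧ e (mk w) ∉ θ.range ∧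
        e (mk w) * θ (k (mk l)) * (e (mk w))⁻¹ ∈ θ.range

variable {e : FreeGroup Λ →* H} {k : FreeGroup Γ →* C} {θ : C →* H}

/-- Transfers a `FactorAlgorithm` back along an embedding of `H`; all its data stay the same. -/
def FactorAlgorithm.ofComp {κ : H →* H'} (hκ : Function.Injective κ)
    (alg : FactorAlgorithm (κ.comp e) k (κ.comp θ)) : FactorAlgorithm e k θ :=
  have hmem {h : H} : κ h ∈ (κ.comp θ).range ↔ h ∈ θ.range := by
    simp only [MonoidHom.mem_range, MonoidHom.comp_apply, hκ.eq_iff]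
  { alg with
    eval_of_rewrite_eq_some := fun w l h => hκ (alg.eval_of_rewrite_eq_some w l h)
    notMem_of_rewrite_eq_none := fun w h => mt hmem.2 (alg.notMem_of_rewrite_eq_none w h)
    eval_incl := fun l => hκ (alg.eval_incl l)
    generatedByShort_conjPullback := fun N D hD w => by
      rw [← conjPullback_comp hκ]
      exact alg.generatedByShort_conjPullback N D hD w
    exists_short_conj := fun l hl a ha hconj => by
      have h := alg.exists_short_conj l hl (κ a) (mt hmem.1 ha)
      simp only [MonoidHom.comp_apply, ← map_mul κ, ← map_inv κ, hmem] at h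
      exact h hconj }

variable [Finite Λ] [Finite Γ]

theorem nonempty_factorAlgorithm_freeGroup {α : Type*} [Finite α] [Primcodable α]
    {e : FreeGroup Λ →* FreeGroup α} (he : Function.Surjective e) (hk : Function.Surjective k)
    {θ : C →* FreeGroup α} (hθ : Function.Injective θ) : Nonempty (FactorAlgorithm e k θ) := by
  classical
  have hrange : (θ.comp k).range = θ.range := by
    rw [MonoidHom.range_comp, MonoidHom.range_eq_top.2 hk, ← MonoidHom.range_eq_map]
  obtain ⟨ρ, hρ, hsome, hnone⟩ := exists_primrec_preimage e (θ.comp k)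
  obtain ⟨j, hj⟩ := exists_lift_of_surjective he (θ.comp k)
  obtain ⟨F, hF, hgen⟩ := exists_primrec_growth e hk hθ
  obtain ⟨B, hB⟩ := exists_length_le_conj_mem he (θ.comp k)
  have hone : PrimrecPred fun l => k (mk l) = 1 :=
    (primrecPred_map_mk_eq_one (θ.comp k)).of_eq fun _ => map_eq_one_iff θ hθ
  rw [hrange] at hnone hB
  exact ⟨{
    rewrite := ρ
    primrec_rewrite := hρ
    eval_of_rewrite_eq_some := hsome
    notMem_of_rewrite_eq_none := hnone
    incl := substWord j
    primrec_incl := primrec_substWord j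
    eval_incl := fun l => by rw [mk_substWord, hj, MonoidHom.comp_apply]
    primrecPred_eq_one := hone
    growth := F
    primrec_growth := hF
    generatedByShort_conjPullback := hgen
    radius := B
    exists_short_conj := fun l hl => hB l ((map_ne_one_iff θ hθ).2 hl) }⟩

theorem nonempty_factorAlgorithm [IsFreeGroup H] (he : Function.Surjective e)
    (hk : Function.Surjective k) (hθ : Function.Injective θ) :
    Nonempty (FactorAlgorithm e k θ) := by
  obtain ⟨r, ⟨κ⟩⟩ := exists_mulEquiv_freeGroup_fin he
  exact (nonempty_factorAlgorithm_freeGroup (e := κ.toMonoidHom.comp e) (κ.surjective.comp he) hk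
    (θ := κ.toMonoidHom.comp θ) (κ.injective.comp hθ)).map (.ofComp κ.injective)

end FactorAlgorithm

open Monoid.PushoutI (of base of_apply_eq_base)

section BlackHole

variable {G : Type*} [Group G] {K : Subgroup G} {g : G}

theorem mem_generalizedNormalizer_iff :
    g ∈ generalizedNormalizer K ↔ ∃ x ∈ K, x ≠ 1 ∧ g⁻¹ * x * g ∈ K := by
  simp only [generalizedNormalizer, Set.mem_ofPred_eq, ne_eq, Subgroup.eq_bot_iff_forall,
    not_forall, Subgroup.mem_inf, Subgroup.mem_map_equiv, MulAut.conj_symm_apply, exists_prop]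
  exact exists_congr fun x => by tauto

theorem mem_blackHole_of_notMem (hg : g ∉ K) :
    g ∈ blackHole K ↔ ∃ x ∈ K, x ≠ 1 ∧ g⁻¹ * x * g ∈ K := by
  rw [← mem_generalizedNormalizer_iff]
  simp only [blackHole, conjStayUnion, conjStaySet, Set.mem_union, Set.mem_sdiff, Set.mem_iUnion,
    SetLike.mem_coe, Set.mem_ofPred_eq, hg, not_false_eq_true, and_true, false_and, exists_false,
    or_false]

theorem mem_blackHole_of_mem (hg : g ∈ K) (hg1 : g ≠ 1) :
    g ∈ blackHole K ↔ ∃ v ∉ K, v * g * v⁻¹ ∈ K := by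
  have hnormalizer {v : G} (hconj : v * g * v⁻¹ ∈ K) : v ∈ generalizedNormalizer K :=
    mem_generalizedNormalizer_iff.2 ⟨_, hconj, by simpa using hg1, by simpa [mul_assoc] using hg⟩
  simp only [blackHole, conjStayUnion, conjStaySet, Set.mem_union, Set.mem_sdiff, Set.mem_iUnion,
    SetLike.mem_coe, Set.mem_ofPred_eq, hg, not_true_eq_false, and_false, false_or, true_and,
    exists_prop]
  exact exists_congr fun v =>
    ⟨fun ⟨⟨_, hv⟩, hconj⟩ => ⟨hv, hconj⟩, fun ⟨hv, hconj⟩ => ⟨⟨hnormalizer hconj, hv⟩, hconj⟩⟩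

end BlackHole

section Amalgam

variable {ι : Type*} {H : ι → Type*} [∀ i, Group (H i)] {C : Type*} [Group C] (θ : ∀ i, C →* H i)

/-- Lists of syllables outside the amalgamated subgroup, neighbours belonging to different factors.
Unlike for `Monoid.CoprodI.Word`, the conditions are a predicate on lists, so that lists can be the
data of an algorithm. -/
def IsReducedList (s : List (Σ i, H i)) : Prop :=
  s.IsChain (fun x y => x.1 ≠ y.1) ∧ ∀ x ∈ s, x.2 ∉ (θ x.1).range

/-- The element of the amalgamated product represented by a list of syllables. -/
def syllableProd (s : List (Σ i, H i)) : Monoid.PushoutI θ :=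
  (s.map fun x => of (φ := θ) x.1 x.2).prod

theorem syllableProd_nil : syllableProd θ [] = 1 := rfl

theorem syllableProd_cons (x : Σ i, H i) (s : List (Σ i, H i)) :
    syllableProd θ (x :: s) = of (φ := θ) x.1 x.2 * syllableProd θ s := by simp [syllableProd]

theorem syllableProd_append (s t : List (Σ i, H i)) :
    syllableProd θ (s ++ t) = syllableProd θ s * syllableProd θ t := by simp [syllableProd]

theorem syllableProd_toList (w : Monoid.CoprodI.Word H) :
    syllableProd θ w.toList = Monoid.PushoutI.ofCoprodI w.prod := by
  simp [Monoid.CoprodI.Word.prod, syllableProd, map_list_prod, Function.comp_def]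

variable {θ} {i : ι} {x : Σ i, H i} {s : List (Σ i, H i)} {c : C}

theorem isReducedList_nil : IsReducedList θ [] := ⟨by simp, by simp⟩

theorem isReducedList_cons :
    IsReducedList θ (x :: s) ↔
      x.2 ∉ (θ x.1).range ∧ (∀ y ∈ s.head?, x.1 ≠ y.1) ∧ IsReducedList θ s := by
  simp only [IsReducedList, List.isChain_cons, List.forall_mem_cons]
  tauto

theorem IsReducedList.eq_nil_of_mem_range (hθ : ∀ i, Function.Injective (θ i))
    (hs : IsReducedList θ s) (h : syllableProd θ s ∈ (base θ).range) : s = [] := by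
  let w : Monoid.CoprodI.Word H := ⟨s, fun x hx h1 => hs.2 x hx (h1 ▸ one_mem _), hs.1⟩
  have hw : Monoid.PushoutI.Reduced θ w := hs.2
  exact congrArg Monoid.CoprodI.Word.toList
    (hw.eq_empty_of_mem_range hθ (syllableProd_toList θ w ▸ h))

theorem of_mem_range_base_iff (hθ : ∀ i, Function.Injective (θ i)) {a : H i} :
    of (φ := θ) i a ∈ (base θ).range ↔ a ∈ (θ i).range := by
  constructor
  · intro h
    by_contra ha
    have hred : IsReducedList θ [⟨i, a⟩] := ⟨by simp, by simpa using ha⟩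
    have hnil := hred.eq_nil_of_mem_range hθ (by rwa [syllableProd_cons, syllableProd_nil, mul_one])
    exact absurd hnil (by simp)
  · rintro ⟨c, rfl⟩
    exact ⟨c, (of_apply_eq_base θ i c).symm⟩

/-- The list of syllables representing the inverse. -/
def invSyllables (s : List (Σ i, H i)) : List (Σ i, H i) :=
  (s.map fun x => (⟨x.1, x.2⁻¹⟩ : Σ i, H i)).reverse

theorem syllableProd_invSyllables (s : List (Σ i, H i)) :
    syllableProd θ (invSyllables s) = (syllableProd θ s)⁻¹ := by
  simp [invSyllables, syllableProd, List.prod_inv_reverse, Function.comp_def]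

theorem isReducedList_invSyllables (hs : IsReducedList θ s) :
    IsReducedList θ (invSyllables s) := by
  refine ⟨?_, ?_⟩
  · rw [invSyllables, List.isChain_reverse, List.isChain_map]
    exact hs.1.imp fun _ _ h => h.symm
  · simp only [invSyllables, List.mem_reverse, List.forall_mem_map, inv_mem_iff]
    exact hs.2

theorem IsReducedList.conj_mem_range (hθ : ∀ i, Function.Injective (θ i))
    (hs : IsReducedList θ (x :: s))
    (h : (syllableProd θ (x :: s))⁻¹ * base θ c * syllableProd θ (x :: s) ∈ (base θ).range) :
    x.2⁻¹ * θ x.1 c * x.2 ∈ (θ x.1).range := by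
  by_contra hc
  obtain ⟨-, hx, hs'⟩ := isReducedList_cons.1 hs
  have hmid : IsReducedList θ (⟨x.1, x.2⁻¹ * θ x.1 c * x.2⟩ :: s) :=
    isReducedList_cons.2 ⟨hc, hx, hs'⟩
  have hchain : (invSyllables s ++ ⟨x.1, x.2⁻¹ * θ x.1 c * x.2⟩ :: s).IsChain
      fun y z => y.1 ≠ z.1 := by
    refine List.isChain_append.2 ⟨(isReducedList_invSyllables hs').1, hmid.1, ?_⟩
    rintro z hz _ ⟨rfl⟩
    simp only [invSyllables, List.getLast?_reverse, List.head?_map] at hz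
    obtain ⟨y, hy, rfl⟩ := Option.mem_map.1 hz
    exact (hx y hy).symm
  have hred : IsReducedList θ (invSyllables s ++ ⟨x.1, x.2⁻¹ * θ x.1 c * x.2⟩ :: s) :=
    ⟨hchain, List.forall_mem_append.2 ⟨(isReducedList_invSyllables hs').2, hmid.2⟩⟩
  refine absurd (hred.eq_nil_of_mem_range hθ ?_) (by simp)
  convert h using 1
  simp only [syllableProd_append, syllableProd_cons, syllableProd_invSyllables, map_mul, map_inv,
    of_apply_eq_base, mul_inv_rev, mul_assoc]

open Monoid.PushoutI in
theorem isReducedList_toList {d : NormalWord.Transversal θ} (w : NormalWord d) :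
    IsReducedList θ w.toList := by
  refine ⟨w.chain_ne, fun x hx hrange => w.ne_one x hx ?_⟩
  have h := (d.compl x.1).1 (a₁ := (⟨x.2, hrange⟩, ⟨1, d.one_mem x.1⟩))
    (a₂ := (1, ⟨x.2, w.normalized x.1 x.2 hx⟩)) (by simp)
  exact congrArg Subtype.val (Prod.ext_iff.1 h).1

open Monoid.PushoutI in
theorem exists_eq_base_mul_syllableProd (hθ : ∀ i, Function.Injective (θ i))
    (g : Monoid.PushoutI θ) :
    ∃ c s, IsReducedList θ s ∧ g = base θ c * syllableProd θ s := by
  classical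
  obtain ⟨d⟩ := NormalWord.transversal_nonempty θ hθ
  let w : NormalWord d := NormalWord.equiv g
  refine ⟨w.head, w.toList, isReducedList_toList w, ?_⟩
  rw [syllableProd_toList]
  exact (NormalWord.equiv.symm_apply_apply g).symm

theorem exists_factor_conj_mem_range (hθ : ∀ i, Function.Injective (θ i)) {v : Monoid.PushoutI θ}
    (hv : v ∉ (base θ).range) (hconj : v * base θ c * v⁻¹ ∈ (base θ).range) :
    ∃ i, ∃ a ∉ (θ i).range, a * θ i c * a⁻¹ ∈ (θ i).range := by
  obtain ⟨b, s, hs, rfl⟩ := exists_eq_base_mul_syllableProd hθ v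
  obtain ⟨t, ht, hst⟩ : ∃ t, IsReducedList θ t ∧ syllableProd θ s = (syllableProd θ t)⁻¹ :=
    ⟨invSyllables s, isReducedList_invSyllables hs, by rw [syllableProd_invSyllables, inv_inv]⟩
  have hb : base θ b ∈ (base θ).range := ⟨b, rfl⟩
  obtain _ | ⟨x, t⟩ := t
  · exact absurd (by rwa [hst, syllableProd_nil, inv_one, mul_one]) hv
  refine ⟨x.1, x.2⁻¹, inv_mem_iff.not.2 (isReducedList_cons.1 ht).1, ?_⟩
  have hassoc (T : Monoid.PushoutI θ) : base θ b * T⁻¹ * base θ c * (base θ b * T⁻¹)⁻¹ =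
      base θ b * (T⁻¹ * base θ c * T) * (base θ b)⁻¹ := by group
  rw [hst, hassoc, (base θ).range.mul_mem_cancel_right (inv_mem hb),
    (base θ).range.mul_mem_cancel_left hb] at hconj
  rw [inv_inv]
  exact ht.conj_mem_range hθ hconj

theorem IsReducedList.conjPullback_syllableProd_cons (hθ : ∀ i, Function.Injective (θ i))
    (hs : IsReducedList θ (x :: s)) :
    conjPullback (base θ) (syllableProd θ (x :: s)) ⊤ =
      conjPullback (θ x.1) x.2 (conjPullback (base θ) (syllableProd θ s) ⊤) := by
  have hconj {c d : C} (hd : x.2⁻¹ * θ x.1 c * x.2 = θ x.1 d) :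
      (syllableProd θ (x :: s))⁻¹ * base θ c * syllableProd θ (x :: s) =
        (syllableProd θ s)⁻¹ * base θ d * syllableProd θ s := by
    rw [← of_apply_eq_base θ x.1 d, ← hd, syllableProd_cons]
    simp only [map_mul, map_inv, of_apply_eq_base, mul_inv_rev, mul_assoc]
  ext c
  simp only [mem_conjPullback, Subgroup.mem_top, true_and]
  constructor
  · rintro ⟨b, hb⟩
    obtain ⟨d, hd⟩ := hs.conj_mem_range hθ ⟨b, hb.symm⟩
    exact ⟨d, ⟨b, hconj hd.symm ▸ hb⟩, hd.symm⟩
  · rintro ⟨d, ⟨b, hb⟩, hd⟩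
    exact ⟨b, (hconj hd).trans hb⟩

end Amalgam

section NormalForm

/-- A syllable of an amalgamated product: a factor, and a word in the generators. -/
abbrev SyllableWord (ι Λ : Type*) := ι × List (Λ × Bool)

/-- What the normal form algorithm computes: a list of syllables, followed by a word in generators
of the amalgamated subgroup. -/
abbrev NormalFormWord (ι Λ Γ : Type*) := List (SyllableWord ι Λ) × List (Γ × Bool)

variable {ι Λ Γ : Type*} {H : ι → Type*} [∀ i, Group (H i)] {C : Type*} [Group C]

/-- The syllables represented by a list of syllable words. -/
def evalSyllables (e : ∀ i, FreeGroup Λ →* H i) (s : List (SyllableWord ι Λ)) : List (Σ i, H i) :=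
  s.map fun y => ⟨y.1, e y.1 (mk y.2)⟩

theorem evalSyllables_cons (e : ∀ i, FreeGroup Λ →* H i) (y : SyllableWord ι Λ)
    (s : List (SyllableWord ι Λ)) :
    evalSyllables e (y :: s) = ⟨y.1, e y.1 (mk y.2)⟩ :: evalSyllables e s := rfl

/-- The element of the amalgamated product represented by a normal form. -/
def evalNormalForm (e : ∀ i, FreeGroup Λ →* H i) (k : FreeGroup Γ →* C) (θ : ∀ i, C →* H i)
    (T : NormalFormWord ι Λ Γ) : Monoid.PushoutI θ :=
  syllableProd θ (evalSyllables e T.1) * base θ (k (mk T.2))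

/-- Merges the word `v` of the factor `i` with the first syllable, if that is of the factor `i`. -/
def absorb [DecidableEq ι] (i : ι) (v : List (Λ × Bool)) (s : List (SyllableWord ι Λ)) :
    List (Λ × Bool) × List (SyllableWord ι Λ) :=
  List.casesOn s (v, []) fun y t => if y.1 = i then (v ++ y.2, t) else (v, y :: t)

variable {e : ∀ i, FreeGroup Λ →* H i} {k : FreeGroup Γ →* C} {θ : ∀ i, C →* H i}
  {s : List (SyllableWord ι Λ)} {T : NormalFormWord ι Λ Γ}

theorem isReducedList_absorb [DecidableEq ι] (i : ι) (v : List (Λ × Bool))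
    (hs : IsReducedList θ (evalSyllables e s)) :
    (∀ y ∈ (evalSyllables e (absorb i v s).2).head?, i ≠ y.1) ∧
      IsReducedList θ (evalSyllables e (absorb i v s).2) := by
  obtain _ | ⟨y, t⟩ := s
  · exact ⟨by simp [absorb, evalSyllables], hs⟩
  by_cases h : y.1 = i
  · simp only [absorb, if_pos h]
    exact h ▸ (isReducedList_cons.1 hs).2
  · simp only [absorb, if_neg h]
    exact ⟨by simpa [evalSyllables, eq_comm] using h, hs⟩

theorem syllableProd_absorb [DecidableEq ι] (i : ι) (v : List (Λ × Bool))
    (s : List (SyllableWord ι Λ)) :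
    of (φ := θ) i (e i (mk (absorb i v s).1)) *
        syllableProd θ (evalSyllables e (absorb i v s).2) =
      of (φ := θ) i (e i (mk v)) * syllableProd θ (evalSyllables e s) := by
  obtain _ | ⟨y, t⟩ := s
  · rfl
  by_cases h : y.1 = i
  · subst h
    simp only [absorb, if_true, evalSyllables_cons, syllableProd_cons, ← mul_mk, map_mul, mul_assoc]
  · simp only [absorb, if_neg h]

variable [Primcodable Λ] [Primcodable Γ] (alg : ∀ i, FactorAlgorithm (e i) k (θ i))

/-- Left multiplication of a normal form by an element of the amalgamated subgroup, which the first
syllable swallows. -/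
def mulBase (l : List (Γ × Bool)) (T : NormalFormWord ι Λ Γ) : NormalFormWord ι Λ Γ :=
  List.casesOn T.1 ([], l ++ T.2) fun y t => ((y.1, (alg y.1).incl l ++ y.2) :: t, T.2)

/-- Left multiplication of a normal form by an element of the factor `i`. -/
def mulFactor [DecidableEq ι] (i : ι) (v : List (Λ × Bool)) (T : NormalFormWord ι Λ Γ) :
    NormalFormWord ι Λ Γ :=
  Option.casesOn ((alg i).rewrite (absorb i v T.1).1)
    ((i, (absorb i v T.1).1) :: (absorb i v T.1).2, T.2)
    fun l => mulBase alg l ((absorb i v T.1).2, T.2)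

/-- The normal form of a word whose letter `z` stands for an element of the factor `side z`. -/
def normalForm [DecidableEq ι] (side : Λ → ι) (w : List (Λ × Bool)) : NormalFormWord ι Λ Γ :=
  w.foldr (fun x T => mulFactor alg (side x.1) [x] T) ([], [])

/-- Bounds the length of words generating the intersection of the amalgamated subgroup with its
conjugate by the element with syllables `s`. -/
def stabilizerBound (s : List (SyllableWord ι Λ)) : ℕ :=
  s.foldr (fun y N => (alg y.1).growth N y.2.length) 1

theorem evalNormalForm_mulBase (l : List (Γ × Bool)) (T : NormalFormWord ι Λ Γ) :
    evalNormalForm e k θ (mulBase alg l T) = base θ (k (mk l)) * evalNormalForm e k θ T := by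
  obtain ⟨_ | ⟨y, t⟩, l'⟩ := T
  · simp [mulBase, evalNormalForm, evalSyllables, syllableProd_nil, ← mul_mk]
  · simp only [mulBase, evalNormalForm, evalSyllables_cons, syllableProd_cons, ← mul_mk, map_mul,
      (alg y.1).eval_incl, of_apply_eq_base, mul_assoc]

theorem isReducedList_mulBase (l : List (Γ × Bool)) (hT : IsReducedList θ (evalSyllables e T.1)) :
    IsReducedList θ (evalSyllables e (mulBase alg l T).1) := by
  obtain ⟨_ | ⟨y, t⟩, l'⟩ := T
  · exact isReducedList_nil
  · simp only [mulBase, evalSyllables_cons, isReducedList_cons, ← mul_mk, map_mul,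
      (alg y.1).eval_incl] at hT ⊢
    rwa [(θ y.1).range.mul_mem_cancel_left ⟨_, rfl⟩]

variable [DecidableEq ι]

theorem evalNormalForm_mulFactor (i : ι) (v : List (Λ × Bool)) (T : NormalFormWord ι Λ Γ) :
    evalNormalForm e k θ (mulFactor alg i v T) =
      of (φ := θ) i (e i (mk v)) * evalNormalForm e k θ T := by
  have habsorb := syllableProd_absorb (e := e) (θ := θ) i v T.1
  unfold mulFactor
  cases h : (alg i).rewrite (absorb i v T.1).1 with
  | none => simp only [evalNormalForm, evalSyllables_cons, syllableProd_cons, habsorb, mul_assoc]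
  | some l =>
    rw [(alg i).eval_of_rewrite_eq_some _ _ h, of_apply_eq_base] at habsorb
    simp only [evalNormalForm_mulBase]
    simp only [evalNormalForm, ← mul_assoc, habsorb]

theorem isReducedList_mulFactor (i : ι) (v : List (Λ × Bool))
    (hT : IsReducedList θ (evalSyllables e T.1)) :
    IsReducedList θ (evalSyllables e (mulFactor alg i v T).1) := by
  obtain ⟨hhead, hred⟩ := isReducedList_absorb i v hT
  unfold mulFactor
  cases h : (alg i).rewrite (absorb i v T.1).1 with
  | none => exact isReducedList_cons.2 ⟨(alg i).notMem_of_rewrite_eq_none _ h, hhead, hred⟩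
  | some l => exact isReducedList_mulBase alg l hred

theorem isReducedList_normalForm (side : Λ → ι) (w : List (Λ × Bool)) :
    IsReducedList θ (evalSyllables e (normalForm alg side w).1) := by
  induction w with
  | nil => exact isReducedList_nil
  | cons x w ih => exact isReducedList_mulFactor alg _ _ ih

variable {side : Λ → ι} {f : FreeGroup Λ →* Monoid.PushoutI θ}
  (hf : ∀ z, f (.of z) = of (side z) (e (side z) (.of z)))

include hf

theorem evalNormalForm_normalForm (w : List (Λ × Bool)) :
    evalNormalForm e k θ (normalForm alg side w) = f (mk w) := by
  have hletter (x : Λ × Bool) : f (mk [x]) = of (side x.1) (e (side x.1) (mk [x])) := by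
    obtain ⟨z, _ | _⟩ := x
    · have hinv : (mk [(z, false)] : FreeGroup Λ) = (.of z)⁻¹ := rfl
      simp only [hinv, map_inv, hf]
    · exact hf z
  induction w with
  | nil =>
    simp only [normalForm, List.foldr_nil, evalNormalForm, evalSyllables, List.map_nil,
      syllableProd_nil, ← one_eq_mk, map_one, mul_one]
  | cons x w ih =>
    have hmul : (mk (x :: w) : FreeGroup Λ) = mk [x] * mk w := rfl
    rw [hmul, map_mul, hletter, ← ih]
    exact evalNormalForm_mulFactor alg _ _ _

theorem map_mk_eq_base_of_eq_nil (w : List (Λ × Bool)) (hw : (normalForm alg side w).1 = []) :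
    f (mk w) = base θ (k (mk (normalForm alg side w).2)) := by
  rw [← evalNormalForm_normalForm alg hf, evalNormalForm, hw]
  exact one_mul _

variable (hθ : ∀ i, Function.Injective (θ i)) (w : List (Λ × Bool))

include hθ

theorem map_mk_mem_range_base_iff :
    f (mk w) ∈ (base θ).range ↔ (normalForm alg side w).1 = [] := by
  rw [← evalNormalForm_normalForm alg hf, evalNormalForm,
    (base θ).range.mul_mem_cancel_right ⟨_, rfl⟩]
  constructor
  · intro h
    simpa [evalSyllables] using (isReducedList_normalForm alg side w).eq_nil_of_mem_range hθ h
  · intro h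
    rw [h]
    exact one_mem _

theorem map_mk_eq_one_iff :
    f (mk w) = 1 ↔ (normalForm alg side w).1 = [] ∧ k (mk (normalForm alg side w).2) = 1 := by
  have hinj := Monoid.PushoutI.base_injective hθ
  constructor
  · intro h
    have hnil := (map_mk_mem_range_base_iff alg hf hθ w).1 (h ▸ one_mem _)
    exact ⟨hnil, (map_eq_one_iff _ hinj).1 (map_mk_eq_base_of_eq_nil alg hf w hnil ▸ h)⟩
  · rintro ⟨hnil, hone⟩
    rw [map_mk_eq_base_of_eq_nil alg hf w hnil, hone, map_one]

end NormalForm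

section PrimrecNormalForm

variable {ι Λ Γ : Type*} [DecidableEq ι] [Finite ι] [Primcodable ι] [Primcodable Λ] [Primcodable Γ]
  {H : ι → Type*} [∀ i, Group (H i)] {C : Type*} [Group C] {e : ∀ i, FreeGroup Λ →* H i}
  {k : FreeGroup Γ →* C} {θ : ∀ i, C →* H i} (alg : ∀ i, FactorAlgorithm (e i) k (θ i))

omit [Finite ι] in
theorem primrec_absorb :
    Primrec fun p : SyllableWord ι Λ × List (SyllableWord ι Λ) => absorb p.1.1 p.1.2 p.2 := by
  refine Primrec.list_casesOn
    (h := fun (p : SyllableWord ι Λ × List (SyllableWord ι Λ))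
      (z : SyllableWord ι Λ × List (SyllableWord ι Λ)) =>
      if z.1.1 = p.1.1 then (p.1.2 ++ z.1.2, z.2) else (p.1.2, z.1 :: z.2))
    .snd (.pair (Primrec.snd.comp .fst) (.const [])) ?_
  have hsame : PrimrecRel fun (p z : SyllableWord ι Λ × List (SyllableWord ι Λ)) =>
      z.1.1 = p.1.1 :=
    Primrec.eq.comp (Primrec.fst.comp (Primrec.fst.comp .snd))
      (Primrec.fst.comp (Primrec.fst.comp .fst))
  have hv : Primrec₂ fun (p _ : SyllableWord ι Λ × List (SyllableWord ι Λ)) => p.1.2 :=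
    Primrec.snd.comp (Primrec.fst.comp .fst)
  exact Primrec.ite hsame
    (.pair (Primrec.list_append.comp hv (Primrec.snd.comp (Primrec.fst.comp .snd)))
      (Primrec.snd.comp .snd))
    (.pair hv (Primrec.list_cons.comp (Primrec.fst.comp .snd) (Primrec.snd.comp .snd)))

omit [DecidableEq ι] in
theorem primrec_mulBase : Primrec₂ (mulBase alg) := by
  refine Primrec.list_casesOn
    (h := fun (p : List (Γ × Bool) × NormalFormWord ι Λ Γ)
      (z : SyllableWord ι Λ × List (SyllableWord ι Λ)) =>
      ((z.1.1, (alg z.1.1).incl p.1 ++ z.1.2) :: z.2, p.2.2))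
    (Primrec.fst.comp .snd)
    (.pair (.const []) (Primrec.list_append.comp .fst (Primrec.snd.comp .snd))) ?_
  have hincl : Primrec₂ fun (p : List (Γ × Bool) × NormalFormWord ι Λ Γ)
      (z : SyllableWord ι Λ × List (SyllableWord ι Λ)) => (alg z.1.1).incl p.1 :=
    (primrec₂_of_finite fun i => (alg i).primrec_incl).comp
      (Primrec.fst.comp (Primrec.fst.comp .snd)) (Primrec.fst.comp .fst)
  exact Primrec.pair (Primrec.list_cons.comp
    (.pair (Primrec.fst.comp (Primrec.fst.comp .snd))
      (Primrec.list_append.comp hincl (Primrec.snd.comp (Primrec.fst.comp .snd))))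
    (Primrec.snd.comp .snd)) (Primrec.snd.comp (Primrec.snd.comp .fst))

theorem primrec_mulFactor :
    Primrec fun p : SyllableWord ι Λ × NormalFormWord ι Λ Γ =>
      mulFactor alg p.1.1 p.1.2 p.2 := by
  have habsorb : Primrec fun p : SyllableWord ι Λ × NormalFormWord ι Λ Γ =>
      absorb p.1.1 p.1.2 p.2.1 := primrec_absorb.comp (.pair .fst (Primrec.fst.comp .snd))
  have hrewrite : Primrec fun p : SyllableWord ι Λ × NormalFormWord ι Λ Γ =>
      (alg p.1.1).rewrite (absorb p.1.1 p.1.2 p.2.1).1 :=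
    (primrec₂_of_finite fun i => (alg i).primrec_rewrite).comp (Primrec.fst.comp .fst)
      (Primrec.fst.comp habsorb)
  exact Primrec.option_casesOn
    (g := fun (p : SyllableWord ι Λ × NormalFormWord ι Λ Γ) l =>
      mulBase alg l ((absorb p.1.1 p.1.2 p.2.1).2, p.2.2))
    hrewrite
    (.pair (Primrec.list_cons.comp (.pair (Primrec.fst.comp .fst) (Primrec.fst.comp habsorb))
      (Primrec.snd.comp habsorb)) (Primrec.snd.comp .snd))
    ((primrec_mulBase alg).comp .snd (.pair (Primrec.snd.comp (habsorb.comp .fst))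
      (Primrec.snd.comp (Primrec.snd.comp .fst))))

theorem primrec_normalForm [Finite Λ] (side : Λ → ι) : Primrec (normalForm alg side) := by
  have hstep : Primrec₂ fun (_ : List (Λ × Bool)) (p : (Λ × Bool) × NormalFormWord ι Λ Γ) =>
      mulFactor alg (side p.1.1) [p.1] p.2 :=
    (primrec_mulFactor alg).comp (.pair
      (.pair ((Primrec.dom_finite side).comp (Primrec.fst.comp (Primrec.fst.comp .snd)))
        (Primrec.list_cons.comp (Primrec.fst.comp .snd) (.const [])))
      (Primrec.snd.comp .snd))
  exact Primrec.list_foldr .id (.const ([], [])) hstep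

omit [DecidableEq ι] in
theorem primrec_stabilizerBound : Primrec (stabilizerBound alg) := by
  have hgrowth : Primrec₂ fun i (p : ℕ × ℕ) => (alg i).growth p.1 p.2 :=
    primrec₂_of_finite fun i => (alg i).primrec_growth
  have hstep : Primrec₂ fun (_ : List (SyllableWord ι Λ)) (p : SyllableWord ι Λ × ℕ) =>
      (alg p.1.1).growth p.2 p.1.2.length :=
    hgrowth.comp (Primrec.fst.comp (Primrec.fst.comp .snd))
      (.pair (Primrec.snd.comp .snd)
        (Primrec.list_length.comp (Primrec.snd.comp (Primrec.fst.comp .snd))))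
  exact Primrec.list_foldr .id (.const 1) hstep

end PrimrecNormalForm

section Regularity

variable {Λ G : Type*} [Primcodable Λ] [Group G] {K : Subgroup G} {f : FreeGroup Λ →* G}

theorem primrecRel_conj_mem (hK : PrimrecPred fun w => f (mk w) ∈ K) :
    PrimrecRel fun v w => f (mk v) * f (mk w) * (f (mk v))⁻¹ ∈ K :=
  (hK.comp (Primrec.list_append.comp (Primrec.list_append.comp .fst .snd)
    (primrec_invRev.comp .fst))).of_eq fun p => by
      rw [← mul_mk, ← mul_mk, ← inv_mk, map_mul, map_mul, map_inv]

theorem primrecPred_mem_regularElements_of_bounded_witnesses [Finite Λ]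
    (hK : PrimrecPred fun w => f (mk w) ∈ K) (hone : PrimrecPred fun w => f (mk w) = 1)
    {B₁ B₂ : List (Λ × Bool) → ℕ} (hB₁ : Primrec B₁) (hB₂ : Primrec B₂)
    (hout : ∀ w, f (mk w) ∉ K → (∃ x ∈ K, x ≠ 1 ∧ (f (mk w))⁻¹ * x * f (mk w) ∈ K) →
      ∃ v : List (Λ × Bool), v.length ≤ B₁ w ∧ f (mk v) ∈ K ∧ f (mk v) ≠ 1 ∧
        (f (mk w))⁻¹ * f (mk v) * f (mk w) ∈ K)
    (hin : ∀ w, f (mk w) ∈ K → f (mk w) ≠ 1 → (∃ g ∉ K, g * f (mk w) * g⁻¹ ∈ K) →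
      ∃ v : List (Λ × Bool), v.length ≤ B₂ w ∧ f (mk v) ∉ K ∧
        f (mk v) * f (mk w) * (f (mk v))⁻¹ ∈ K) :
    PrimrecPred fun w => f (mk w) ∈ regularElements K := by
  classical
  have hsearchOut := primrecPred_exists_length_le (R := fun w v =>
    f (mk v) ∈ K ∧ f (mk v) ≠ 1 ∧ (f (mk w))⁻¹ * f (mk v) * f (mk w) ∈ K)
    ((hK.comp .snd).and ((hone.comp .snd).not.and
      (((primrecRel_conj_mem hK).comp (primrec_invRev.comp .fst) .snd).of_eq fun p => by
        rw [← inv_mk, map_inv, inv_inv]))) hB₁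
  have hsearchIn := primrecPred_exists_length_le (R := fun w v =>
    f (mk v) ∉ K ∧ f (mk v) * f (mk w) * (f (mk v))⁻¹ ∈ K)
    ((hK.comp .snd).not.and ((primrecRel_conj_mem hK).comp .snd .fst)) hB₂
  -- Whether `1` is regular is a single truth value, so no algorithm for it is needed.
  have hunit : PrimrecPred fun _ : List (Λ × Bool) => (1 : G) ∈ blackHole K :=
    (Primrec.const (decide ((1 : G) ∈ blackHole K))).primrecPred
  refine (PrimrecPred.not ((hK.not.and hsearchOut).or (hK.and
    ((hone.and hunit).or (hone.not.and hsearchIn))))).of_eq fun w => ?_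
  rw [regularElements, Set.mem_compl_iff, not_iff_not]
  by_cases hw : f (mk w) ∈ K
  · by_cases hw1 : f (mk w) = 1
    · simp only [hw1, one_mem, not_true_eq_false, false_and, false_or, true_and, or_false]
    · rw [mem_blackHole_of_mem hw hw1]
      simp only [hw, hw1, not_true_eq_false, not_false_eq_true, false_and, false_or, true_and]
      exact ⟨fun ⟨v, _, hv⟩ => ⟨_, hv⟩, hin w hw hw1⟩
  · rw [mem_blackHole_of_notMem hw]
    simp only [hw, not_false_eq_true, false_and, or_false, true_and]
    exact ⟨fun ⟨v, _, hv⟩ => ⟨_, hv⟩, hout w hw⟩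

end Regularity

section RegularityInPushout

variable {ι Λ Γ : Type*} [Primcodable Λ] [Primcodable Γ] {H : ι → Type*} [∀ i, Group (H i)]
  {C : Type*} [Group C] {e : ∀ i, FreeGroup Λ →* H i} {k : FreeGroup Γ →* C} {θ : ∀ i, C →* H i}
  (alg : ∀ i, FactorAlgorithm (e i) k (θ i)) (hk : Function.Surjective k)
  (hθ : ∀ i, Function.Injective (θ i))

include hk hθ in
theorem generatedByShort_stabilizerBound {s : List (SyllableWord ι Λ)}
    (hs : IsReducedList θ (evalSyllables e s)) :
    GeneratedByShort k (stabilizerBound alg s)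
      (conjPullback (base θ) (syllableProd θ (evalSyllables e s)) ⊤) := by
  induction s with
  | nil =>
    have htop : conjPullback (base θ) 1 ⊤ = ⊤ := by
      ext c
      simp [mem_conjPullback_top]
    rw [evalSyllables, List.map_nil, syllableProd_nil, htop]
    exact generatedByShort_top hk
  | cons y s ih =>
    rw [evalSyllables_cons] at hs ⊢
    rw [hs.conjPullback_syllableProd_cons hθ]
    exact (alg y.1).generatedByShort_conjPullback _ _ (ih (isReducedList_cons.1 hs).2.2) y.2

variable {f : FreeGroup Λ →* Monoid.PushoutI θ} (hsurj : Function.Surjective f)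

include alg hθ hsurj in
theorem exists_length_le_conj_mem_base [Finite ι] [Finite Λ] :
    ∃ B : ℕ, ∀ l : List (Γ × Bool), k (mk l) ≠ 1 →
    (∃ v ∉ (base θ).range, v * base θ (k (mk l)) * v⁻¹ ∈ (base θ).range) →
      ∃ v : List (Λ × Bool), v.length ≤ B * (l.length + 1) ∧ f (mk v) ∉ (base θ).range ∧
        f (mk v) * base θ (k (mk l)) * (f (mk v))⁻¹ ∈ (base θ).range := by
  choose M hM using fun i =>
    exists_length_le_mul_of_surjective hsurj ((of (φ := θ) i).comp (e i))
  obtain ⟨B, hB⟩ := Finite.exists_le fun i => M i * (alg i).radius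
  refine ⟨B, fun l hl ⟨v, hv, hconj⟩ => ?_⟩
  obtain ⟨i, a, ha, hai⟩ := exists_factor_conj_mem_range hθ hv hconj
  obtain ⟨w, hw, hwnot, hwconj⟩ := (alg i).exists_short_conj l hl a ha hai
  obtain ⟨u, hu, hfu⟩ := hM i w
  rw [MonoidHom.comp_apply] at hfu
  refine ⟨u, ?_, ?_, ?_⟩
  · calc u.length ≤ M i * w.length := hu
      _ ≤ M i * ((alg i).radius * (l.length + 1)) := by gcongr
      _ = M i * (alg i).radius * (l.length + 1) := (mul_assoc ..).symm
      _ ≤ B * (l.length + 1) := by gcongr; exact hB i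
  · rwa [hfu, of_mem_range_base_iff hθ]
  · rwa [hfu, ← of_apply_eq_base θ i, ← map_inv, ← map_mul, ← map_mul, of_mem_range_base_iff hθ]

variable {side : Λ → ι}
  (hf : ∀ z, f (.of z) = of (side z) (e (side z) (.of z)))

include hk hθ hf in
theorem exists_short_conj_preimage [DecidableEq ι] {w : List (Λ × Bool)}
    (h : ∃ x ∈ (base θ).range, x ≠ 1 ∧ (f (mk w))⁻¹ * x * f (mk w) ∈ (base θ).range) :
    ∃ l : List (Γ × Bool), l.length ≤ stabilizerBound alg (normalForm alg side w).1 ∧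
      k (mk l) ≠ 1 ∧ (f (mk w))⁻¹ * base θ (k (mk l)) * f (mk w) ∈ (base θ).range := by
  have hgen := generatedByShort_stabilizerBound alg hk hθ (isReducedList_normalForm alg side w)
  rw [← conjPullback_mul_top _ _ (k (mk (normalForm alg side w).2))] at hgen
  change GeneratedByShort k _ (conjPullback _ (evalNormalForm e k θ (normalForm alg side w)) _)
    at hgen
  rw [evalNormalForm_normalForm alg hf] at hgen
  obtain ⟨_, ⟨c, rfl⟩, hc, hconj⟩ := h
  have hne : conjPullback (base θ) (f (mk w)) ⊤ ≠ ⊥ := fun hbot =>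
    ne_of_apply_ne (base θ) (by rwa [map_one])
      (Subgroup.mem_bot.1 (hbot ▸ mem_conjPullback_top.2 hconj))
  obtain ⟨l, hl, hmem, hl1⟩ := hgen.exists_ne_one hne
  exact ⟨l, hl, hl1, mem_conjPullback_top.1 hmem⟩

variable [Finite ι] [Nonempty ι] [Primcodable ι] [Finite Λ] [Finite Γ]

include hθ hk hf hsurj alg in
theorem primrecPred_mem_regularElements_base :
    PrimrecPred fun w => f (mk w) ∈ regularElements (base θ).range := by
  classical
  have hnf := primrec_normalForm alg side
  have hnil : PrimrecPred fun w => (normalForm alg side w).1 = [] :=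
    Primrec.eq.comp (Primrec.fst.comp hnf) (.const [])
  have hmem : PrimrecPred fun w => f (mk w) ∈ (base θ).range :=
    hnil.of_eq fun w => (map_mk_mem_range_base_iff alg hf hθ w).symm
  have hone : PrimrecPred fun w => f (mk w) = 1 :=
    (hnil.and ((alg (Classical.arbitrary ι)).primrecPred_eq_one.comp
      (Primrec.snd.comp hnf))).of_eq fun w => (map_mk_eq_one_iff alg hf hθ w).symm
  obtain ⟨M, hM⟩ := exists_length_le_mul_of_surjective hsurj ((base θ).comp k)
  obtain ⟨B, hB⟩ := exists_length_le_conj_mem_base alg hθ hsurj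
  refine primrecPred_mem_regularElements_of_bounded_witnesses hmem hone
    (B₁ := fun w => M * stabilizerBound alg (normalForm alg side w).1)
    (B₂ := fun w => B * ((normalForm alg side w).2.length + 1))
    (Primrec.nat_mul.comp (.const M) ((primrec_stabilizerBound alg).comp (Primrec.fst.comp hnf)))
    (Primrec.nat_mul.comp (.const B)
      (Primrec.succ.comp (Primrec.list_length.comp (Primrec.snd.comp hnf)))) ?_ ?_
  · intro w _ hw
    obtain ⟨l, hl, hl1, hconj⟩ := exists_short_conj_preimage alg hk hθ hf hw
    obtain ⟨v, hv, hfv⟩ := hM l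
    rw [MonoidHom.comp_apply] at hfv
    refine ⟨v, hv.trans (by gcongr), hfv ▸ ⟨_, rfl⟩, ?_, hfv ▸ hconj⟩
    rwa [hfv, ne_eq, map_eq_one_iff _ (Monoid.PushoutI.base_injective hθ)]
  · intro w hw hw1 hconj
    have hbase := map_mk_eq_base_of_eq_nil alg hf w ((map_mk_mem_range_base_iff alg hf hθ w).1 hw)
    rw [hbase] at hw1 hconj ⊢
    exact hB _ (ne_of_apply_ne (base θ) (by rwa [map_one])) hconj

end RegularityInPushout

section FiniteFamily

variable {ι : Type*} {H : ι → Type*} [∀ i, Group (H i)] {C : Type*} [Group C]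

theorem exists_freeGroup_fin_surjective [Group.FG C] :
    ∃ (r : ℕ) (k : FreeGroup (Fin r) →* C), Function.Surjective k := by
  obtain ⟨Γ, _, k, hk⟩ := Group.fg_iff_exists_freeGroup_hom_surjective_finite.1 ‹Group.FG C›
  obtain ⟨r, ⟨σ⟩⟩ := Finite.exists_equiv_fin Γ
  exact ⟨r, k.comp (freeGroupCongr σ.symm).toMonoidHom, hk.comp (freeGroupCongr σ.symm).surjective⟩

variable {Λ : Type*} {x : Λ → Σ i, H i}
  (hx : ∀ i, Subgroup.closure (Sigma.mk i ⁻¹' Set.range x) = ⊤)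

include hx in
theorem lift_mulSingle_surjective [DecidableEq ι] (i : ι) :
    Function.Surjective (lift fun z => Pi.mulSingle (x z).1 (x z).2 i) := by
  refine lift_surjective_iff_closure_range_eq_top.2 (top_le_iff.1 ?_)
  rw [← hx i]
  refine Subgroup.closure_mono ?_
  rintro a ⟨z, hz⟩
  exact ⟨z, by dsimp only; rw [hz, Pi.mulSingle_eq_same]⟩

include hx in
theorem lift_of_surjective [Nonempty ι] (θ : ∀ i, C →* H i) :
    Function.Surjective (lift fun z => of (φ := θ) (x z).1 (x z).2) := by
  have hof (i : ι) (a : H i) :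
      of (φ := θ) i a ∈ (lift fun z => of (φ := θ) (x z).1 (x z).2).range := by
    suffices h : Subgroup.closure (Sigma.mk i ⁻¹' Set.range x) ≤
        (lift fun z => of (φ := θ) (x z).1 (x z).2).range.comap (of (φ := θ) i) from
      h (hx i ▸ Subgroup.mem_top a)
    refine (Subgroup.closure_le _).2 ?_
    rintro b ⟨z, hz⟩
    exact ⟨.of z, by rw [lift_apply_of, hz]⟩
  intro g
  rw [← MonoidHom.mem_range]
  induction g using Monoid.PushoutI.induction_on with
  | of i a => exact hof i a
  | base c => exact of_apply_eq_base θ (Classical.arbitrary ι) c ▸ hof _ _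
  | mul g h hg hh => exact mul_mem hg hh

end FiniteFamily

theorem mainTheorem7_general {ι : Type*} [Finite ι] [Nonempty ι] {H : ι → Type*}
    [∀ i, Group (H i)] [∀ i, IsFreeGroup (H i)] {C : Type*} [Group C] [Group.FG C]
    (θ : ∀ i, C →* H i) (hθ : ∀ i, Function.Injective (θ i))
    {Λ : Type*} [Finite Λ] [Primcodable Λ] (x : Λ → Σ i, H i)
    (hx : ∀ i, Subgroup.closure (Sigma.mk i ⁻¹' Set.range x) = ⊤) :
    PrimrecPred fun w : List (Λ × Bool) =>
      lift (fun z => of (φ := θ) (x z).1 (x z).2) (mk w) ∈ regularElements (base θ).range := by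
  classical
  obtain ⟨n, ⟨σ⟩⟩ := Finite.exists_equiv_fin ι
  let : Primcodable ι := Primcodable.ofEquiv (Fin n) σ
  obtain ⟨r, k, hk⟩ := exists_freeGroup_fin_surjective (C := C)
  let e (i : ι) : FreeGroup Λ →* H i := lift fun z => Pi.mulSingle (x z).1 (x z).2 i
  let alg (i : ι) : FactorAlgorithm (e i) k (θ i) :=
    (nonempty_factorAlgorithm (lift_mulSingle_surjective hx i) hk (hθ i)).some
  refine primrecPred_mem_regularElements_base alg hk hθ (lift_of_surjective hx θ)
    (side := fun z => (x z).1) fun z => ?_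
  rw [lift_apply_of, lift_apply_of, Pi.mulSingle_eq_same]

section TwoFactors

variable {A B : Type u} {C : Type v} [Group A] [Group B] [Group C]

instance AmalgamFactor.instIsFreeGroup [IsFreeGroup A] [IsFreeGroup B] :
    ∀ b, IsFreeGroup (AmalgamFactor A B b)
  | false => inferInstanceAs (IsFreeGroup A)
  | true => inferInstanceAs (IsFreeGroup B)

theorem amalgamLegs_injective {φ : C →* A} {ψ : C →* B} (hφ : Function.Injective φ)
    (hψ : Function.Injective ψ) : ∀ b, Function.Injective (amalgamLegs φ ψ b)
  | false => hφ
  | true => hψ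

/-- The tuples of generators of `A` and of `B` as a single tuple in the disjoint union. -/
def factorLetter {m n : ℕ} (x : Fin m → A) (y : Fin n → B) :
    Fin m ⊕ Fin n → Σ b, AmalgamFactor A B b :=
  Sum.elim (fun i => ⟨false, x i⟩) fun j => ⟨true, y j⟩

variable {m n : ℕ} {x : Fin m → A} {y : Fin n → B}

theorem closure_preimage_range_factorLetter (hx : Subgroup.closure (Set.range x) = ⊤)
    (hy : Subgroup.closure (Set.range y) = ⊤) (b : Bool) :
    Subgroup.closure (Sigma.mk b ⁻¹' Set.range (factorLetter x y)) = ⊤ := by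
  cases b
  · refine top_le_iff.1 (hx.ge.trans (Subgroup.closure_mono ?_))
    rintro _ ⟨i, rfl⟩
    exact ⟨.inl i, rfl⟩
  · refine top_le_iff.1 (hy.ge.trans (Subgroup.closure_mono ?_))
    rintro _ ⟨j, rfl⟩
    exact ⟨.inr j, rfl⟩

theorem evalWord_eq_lift_factorLetter (φ : C →* A) (ψ : C →* B)
    (w : List ((Fin m ⊕ Fin n) × Bool)) :
    AmalgamatedProduct.evalWord φ ψ x y w =
      lift (fun z => of (φ := amalgamLegs φ ψ) (factorLetter x y z).1 (factorLetter x y z).2)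
        (mk w) := by
  unfold AmalgamatedProduct.evalWord
  congr 2
  ext (i | j) <;> rfl

end TwoFactors

theorem mainTheorem7 {A B : Type u} {C : Type v} [Group A] [Group B] [Group C]
    [IsFreeGroup A] [IsFreeGroup B] [Group.FG C]
    (φ : C →* A) (ψ : C →* B) (hφ : Function.Injective φ) (hψ : Function.Injective ψ)
    {m n : ℕ} (x : Fin m → A) (y : Fin n → B)
    (hx : Subgroup.closure (Set.range x) = ⊤) (hy : Subgroup.closure (Set.range y) = ⊤) :
    ComputablePred fun w : List ((Fin m ⊕ Fin n) × Bool) =>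
      AmalgamatedProduct.evalWord φ ψ x y w ∈
        regularElements (AmalgamatedProduct.baseSubgroup φ ψ) :=
  (mainTheorem7_general _ (amalgamLegs_injective hφ hψ) (factorLetter x y)
    (closure_preimage_range_factorLetter hx hy)).computablePred.of_eq fun w => by
      rw [evalWord_eq_lift_factorLetter, AmalgamatedProduct.baseSubgroup]
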